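/- Let $A,K,D,a_1,b_0$ be real numbers with $A>0$, $K\ne0$, $D\ge2$, $b_0\ne0$ and $A^2-4KD^2>0$, and consider the continued fraction $$\mathcal C=[[0,a_1,A(n-1)],[b_0,-K(Dn-1)(D(n-1)+1)]]=b_0/(a_1+b(1)/(a(2)+b(2)/(a(3)+b(3)/(a(4)+\cdots)))),$$ where $a(n)=A(n-1)$ for $n\ge2$ and $b(n)=-K(Dn-1)(D(n-1)+1)$ for $n\ge1$. Let $p(n)$ and $q(n)$ be the numerator and denominator of its $n$th convergent, so that $p(0)=0$, $q(0)=1$, $p(1)=b_0$, $q(1)=a_1$, and $v_{n+1}=a(n+1)v_n+b(n)v_{n-1}$ for $n\ge1$, for both $v=p$ and $v=q$. Put $$R=\frac{A+\sqrt{A^2-4KD^2}}2,\qquad E=\frac{R^2}{KD^2},\qquad f(n)=|K|^{\lfloor n/2\rfloor}\prod_{1\le j\le n}(D(j-1)+1),$$ and $(p'(n),q'(n))=(p(n),q(n))/f(n)$. For $n\ge0$ let $$T_n(a,b;z)=\frac{\Gamma(a+n)\Gamma(b+n)}{\Gamma(2a+2n)}(1/z)^{a+n}\,{}_2F_1(a+n,b+n;2a+2n;1/z),$$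 where ${}_2F_1$ is the principal branch of the Gauss hypergeometric function, that is, the analytic continuation of its power series to $\mathbb C\setminus[1,\infty)$. Let $K^{1/2}$ be the principal square root (so $K^{1/2}=i|K|^{1/2}$ if $K<0$), let $$z_0=\frac12+\frac{A}{4DK^{1/2}},\qquad Q=\frac{T_1(1/2,1-1/D;z_0)}{T_0(1/2,1-1/D;z_0)},$$ and assume that $a_1\ne K^{1/2}Q$. Then $T_0(1/2,1-1/D;z_0)\ne0$, $|E|>1$, and $p(n)/q(n)$ converges to a real limit $L$, exponentially fast; more precisely: 1. There are nonzero real constants $C_1,C_2$ such that, as $n\to\infty$, $$L-\frac{p(n)}{q(n)}\sim\frac{C_1}{E^n},\qquad q(n)\sim C_2\,(n-1)!\,R^n,\qquad \log|q'(n)L-p'(n)|\sim-\frac{n\log|E|}{2}.$$ 2. The limit is $$L=\frac{b_0}{a_1-K^{1/2}Q}.$$ -/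

import Mathlib

open Filter Topology Asymptotics

noncomputable section

namespace ContFracT

/-- The complex plane cut along the real half-line `[1, ∞)`. -/
def cutPlane : Set ℂ := {x : ℂ | x.re < 1 ∨ x.im ≠ 0}

/-- `F` is holomorphic on `ℂ ∖ [1, ∞)` and equals the Gauss series `₂F₁ a b c` on the open
unit disc. As `ℂ ∖ [1, ∞)` is connected, there is at most one such function on it. -/
def IsHypergeometricContinuation (a b c : ℂ) (F : ℂ → ℂ) : Prop :=
  AnalyticOnNhd ℂ F cutPlane ∧ ∀ x : ℂ, ‖x‖ < 1 → F x = ₂F₁ a b c x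

open Classical in
/-- The principal branch of the Gauss hypergeometric function: the analytic continuation of the
power series to `ℂ ∖ [1, ∞)` (and the bare series should there be no continuation). -/
def hyp2F1 (a b c : ℂ) : ℂ → ℂ :=
  if h : ∃ F : ℂ → ℂ, IsHypergeometricContinuation a b c F then h.choose else ₂F₁ a b c

/-- `T_n(a,b;z) = Γ(a+n) Γ(b+n) / Γ(2a+2n) (1/z)^(a+n) ₂F₁(a+n, b+n; 2a+2n; 1/z)`. -/
def T (n : ℕ) (a b z : ℂ) : ℂ :=
  Complex.Gamma (a + n) * Complex.Gamma (b + n) / Complex.Gamma (2 * a + 2 * n)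
    * (1 / z) ^ (a + (n : ℂ)) * hyp2F1 (a + n) (b + n) (2 * a + 2 * n) (1 / z)

/-- The principal square root `K^(1/2)`, which is `i |K|^(1/2)` for `K < 0`. -/
def sqrtC (K : ℝ) : ℂ := (K : ℂ) ^ (1 / 2 : ℂ)

/-- `Q = (T_1 / T_0)(1/2, 1 - 1/D; 1/2 + A / (4 D K^(1/2)))`. -/
def Q (A K D : ℝ) : ℂ :=
  T 1 (1 / 2) (1 - 1 / (D : ℂ)) (1 / 2 + (A : ℂ) / (4 * (D : ℂ) * sqrtC K)) /
    T 0 (1 / 2) (1 - 1 / (D : ℂ)) (1 / 2 + (A : ℂ) / (4 * (D : ℂ) * sqrtC K))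

/-- `[[a₀, a(1), a(n)], [b₀, b(n)]] = a₀ + b₀ / (a(1) + b(1) / (a(2) + b(2) / (a(3) + ⋯)))`, where
`a : ℕ → ℝ` is used at `n ≥ 1` and `b : ℕ → ℝ` at `n ≥ 0`, with `b 0 = b₀`. -/
def cf (a₀ : ℝ) (a b : ℕ → ℝ) : GenContFract ℝ where
  h := a₀
  s := Stream'.Seq.ofStream (fun i : ℕ => (⟨b i, a (i + 1)⟩ : GenContFract.Pair ℝ))

/-- The continued fraction `[[0, a₁, A(n-1)], [b₀, -K(Dn-1)(D(n-1)+1)]]`. -/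
def cfC (A K D a₁ b₀ : ℝ) : GenContFract ℝ :=
  cf 0 (fun n => if n = 1 then a₁ else A * ((n : ℝ) - 1))
    (fun n => if n = 0 then b₀ else -K * (D * (n : ℝ) - 1) * (D * ((n : ℝ) - 1) + 1))

/-- The numerator `p(n)` of the `n`-th convergent: `p(0) = 0`, `p(1) = b₀`. -/
def p (A K D a₁ b₀ : ℝ) (n : ℕ) : ℝ := (cfC A K D a₁ b₀).nums n

/-- The denominator `q(n)` of the `n`-th convergent: `q(0) = 1`, `q(1) = a₁`. -/
def q (A K D a₁ b₀ : ℝ) (n : ℕ) : ℝ := (cfC A K D a₁ b₀).dens n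

/-- `f(n) = |K|^⌊n/2⌋ ∏_{1 ≤ j ≤ n} (D(j-1)+1)`. -/
def f (K D : ℝ) (n : ℕ) : ℝ :=
  |K| ^ (n / 2) * ∏ j ∈ Finset.Icc 1 n, (D * ((j : ℝ) - 1) + 1)

/-- The normalized numerator `p'(n) = p(n) / f(n)`. -/
def p' (A K D a₁ b₀ : ℝ) (n : ℕ) : ℝ := p A K D a₁ b₀ n / f K D n

/-- The normalized denominator `q'(n) = q(n) / f(n)`. -/
def q' (A K D a₁ b₀ : ℝ) (n : ℕ) : ℝ := q A K D a₁ b₀ n / f K D n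

/-- `R = (A + √(A² - 4KD²)) / 2`. -/
def R (A K D : ℝ) : ℝ := (A + Real.sqrt (A ^ 2 - 4 * K * D ^ 2)) / 2

/-- `E = R² / (K D²)`. -/
def E (A K D : ℝ) : ℝ := R A K D ^ 2 / (K * D ^ 2)

end ContFracT

end

/-! Dividing a solution `v n` of the recurrence by `(n-1)! R^n` turns it into a solution of a
perturbation, with summable errors of order `1/n²`, of the constant-coefficient recurrence with
characteristic roots `1` and `r = KD²/R² = 1/E`, where `|r| < 1`. So every normalized solution
converges (`IsSol.tendsto`), and any two with limit `0` are proportional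
(`IsSol.proportional_of_tendsto_zero`): otherwise their Casoratian, which has exact order `r^n`,
would be too small.

One such null solution is explicit. The Fourier coefficients `∫₀^π cos(2nφ) (1 - x sin²φ)^(-b) dφ`
with `b = 1 - 1/D`, `x = 1/z₀` satisfy a three-term recurrence, which the factor `(-K^(1/2))^n
∏(Dj+1)` turns into that of the convergents (`isConvergentSol_minimalSol`). They are bounded, so the
normalized solution tends to `0` (`tendsto_minimalSol`). Up to elementary factors the coefficients
of index `0` and `1` are Euler integrals for `T₀` and `T₁`, so the first two values of this minimal
solution have ratio `K^(1/2) Q` (`sqrtC_mul_Q`).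

The hypothesis `a₁ ≠ K^(1/2) Q` thus says that `q` is not minimal: its normalized limit is nonzero,
and `p/q` converges to some `L`. The Casoratian gives the increments of `p/q`, hence the rate
`E^(-n)`. Finally `p - Lq` is null, so proportional to the minimal solution; comparing values at `0`
and `1` yields `L`. -/

/-! ### Perturbations of a second order recurrence with characteristic roots `1` and `r` -/

namespace PerturbedRecurrence

/-- `x` solves `x (k + 2) = (1 + r) x (k + 1) - r (1 + e k) x k`. -/
def IsSol {𝕜 : Type*} [NormedField 𝕜] (r : 𝕜) (e x : ℕ → 𝕜) : Prop :=
  ∀ k, x (k + 2) = (1 + r) * x (k + 1) - r * (1 + e k) * x k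

variable {𝕜 : Type*} [NormedField 𝕜] {r : 𝕜} {e x y : ℕ → 𝕜}

/-- The weight `c = 1/(1-‖r‖)` satisfies `1 + c‖r‖ = c`, so `‖x k‖ + c‖x (k+1) - x k‖` would not
increase without perturbation; with it, each step costs a factor at most `1 + c‖e k‖`, and the
product of these converges. -/
lemma IsSol.bounded (hx : IsSol r e x) (hr : ‖r‖ < 1) (he : Summable fun k => ‖e k‖) :
    ∃ M, 0 ≤ M ∧ ∀ k, ‖x k‖ ≤ M := by
  set c : ℝ := 1 / (1 - ‖r‖) with hc
  have h1 : 0 < 1 - ‖r‖ := by linarith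
  have hc0 : 0 < c := by positivity
  have hcr : 1 + c * ‖r‖ = c := by rw [hc]; field_simp; ring
  set N : ℕ → ℝ := fun k => ‖x k‖ + c * ‖x (k + 1) - x k‖ with hN
  have hN0 : ∀ k, 0 ≤ N k := fun k => add_nonneg (norm_nonneg _) (mul_nonneg hc0.le (norm_nonneg _))
  have hstep : ∀ k, N (k + 1) ≤ (1 + c * ‖e k‖) * N k := by
    intro k
    have e1 : x (k + 1 + 1) - x (k + 1) = r * (x (k + 1) - x k) - r * (e k * x k) := by
      rw [hx k]; ring
    have e2 : ‖x (k + 1 + 1) - x (k + 1)‖ ≤ ‖r‖ * ‖x (k + 1) - x k‖ + ‖e k‖ * ‖x k‖ := by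
      rw [e1]
      refine (norm_sub_le _ _).trans ?_
      rw [norm_mul, norm_mul, norm_mul]
      refine add_le_add_right ?_ _
      exact mul_le_of_le_one_left (by positivity) hr.le
    have e3 : ‖x (k + 1)‖ ≤ ‖x k‖ + ‖x (k + 1) - x k‖ := by
      simpa using norm_add_le (x k) (x (k + 1) - x k)
    have e4 : N (k + 1) ≤ ‖x k‖ + ‖x (k + 1) - x k‖
        + c * (‖r‖ * ‖x (k + 1) - x k‖ + ‖e k‖ * ‖x k‖) := by
      simp only [hN]; gcongr
    have e5 : 0 ≤ c * ‖e k‖ * (c * ‖x (k + 1) - x k‖) := by positivity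
    have e6 : (1 + c * ‖e k‖) * N k = ‖x k‖ + (1 + c * ‖r‖) * ‖x (k + 1) - x k‖
        + c * ‖e k‖ * ‖x k‖ + c * ‖e k‖ * (c * ‖x (k + 1) - x k‖) := by
      rw [hcr]; simp only [hN]; ring
    rw [e6]; nlinarith
  have hexp : ∀ k, N k ≤ N 0 * Real.exp (c * ∑ j ∈ Finset.range k, ‖e j‖) := by
    intro k
    induction k with
    | zero => simp
    | succ k ih =>
      rw [Finset.sum_range_succ, mul_add, Real.exp_add]
      calc N (k + 1) ≤ (1 + c * ‖e k‖) * N k := hstep k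
        _ ≤ Real.exp (c * ‖e k‖) * (N 0 * Real.exp (c * ∑ j ∈ Finset.range k, ‖e j‖)) := by
          gcongr
          linarith [Real.add_one_le_exp (c * ‖e k‖)]
        _ = _ := by ring
  refine ⟨N 0 * Real.exp (c * ∑' j, ‖e j‖), mul_nonneg (hN0 0) (Real.exp_pos _).le, fun k => ?_⟩
  calc ‖x k‖ ≤ N k := le_add_of_nonneg_right (by positivity)
    _ ≤ _ := hexp k
    _ ≤ _ := by
      gcongr
      exact he.sum_le_tsum _ (fun _ _ => norm_nonneg _)

/-- Each increment is at most `‖r‖` times the previous one plus a summable error, since `x` is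
bounded; hence the increments are summable. -/
lemma IsSol.tendsto [CompleteSpace 𝕜] (hx : IsSol r e x) (hr : ‖r‖ < 1)
    (he : Summable fun k => ‖e k‖) : ∃ C, Tendsto x atTop (𝓝 C) := by
  obtain ⟨M, hM0, hM⟩ := hx.bounded hr he
  have h1 : 0 < 1 - ‖r‖ := by linarith
  set d : ℕ → ℝ := fun k => dist (x k) (x k.succ) with hd
  have hd' : ∀ k, d k = ‖x (k + 1) - x k‖ := fun k => by rw [hd]; simp [dist_eq_norm_sub']
  have hstep : ∀ k, d (k + 1) ≤ ‖r‖ * d k + M * ‖e k‖ := by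
    intro k
    rw [hd', hd']
    have e1 : x (k + 1 + 1) - x (k + 1) = r * (x (k + 1) - x k) - r * (e k * x k) := by
      rw [hx k]; ring
    rw [e1]
    refine (norm_sub_le _ _).trans ?_
    rw [norm_mul, norm_mul, norm_mul]
    refine add_le_add_right ?_ _
    calc ‖r‖ * (‖e k‖ * ‖x k‖) ≤ ‖e k‖ * ‖x k‖ := mul_le_of_le_one_left (by positivity) hr.le
      _ ≤ ‖e k‖ * M := by gcongr; exact hM k
      _ = _ := mul_comm _ _
  set B := d 0 + M * ∑' j, ‖e j‖ with hB
  have hB0 : 0 ≤ B := by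
    have : 0 ≤ ∑' j, ‖e j‖ := tsum_nonneg fun _ => norm_nonneg _
    have : 0 ≤ d 0 := dist_nonneg
    positivity
  have hsum : Summable d := by
    -- `B / (1 - ‖r‖)` is the fixed point of `S ↦ ‖r‖ S + B`, so the bound on partial sums
    -- propagates.
    refine summable_of_sum_range_le (c := B / (1 - ‖r‖)) (fun _ => dist_nonneg) fun n => ?_
    induction n with
    | zero => simp; positivity
    | succ n ih =>
      rw [Finset.sum_range_succ']
      calc ∑ k ∈ Finset.range n, d (k + 1) + d 0
          ≤ ∑ k ∈ Finset.range n, (‖r‖ * d k + M * ‖e k‖) + d 0 := by gcongr; exact hstep _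
        _ = ‖r‖ * ∑ k ∈ Finset.range n, d k + M * ∑ k ∈ Finset.range n, ‖e k‖ + d 0 := by
          rw [Finset.sum_add_distrib, Finset.mul_sum, Finset.mul_sum]
        _ ≤ ‖r‖ * (B / (1 - ‖r‖)) + M * ∑' k, ‖e k‖ + d 0 := by
          gcongr
          exact he.sum_le_tsum _ (fun _ _ => norm_nonneg _)
        _ = ‖r‖ * (B / (1 - ‖r‖)) + B := by rw [hB]; ring
        _ = B / (1 - ‖r‖) := by field_simp; ring
  exact cauchySeq_tendsto_of_complete (cauchySeq_of_summable_dist hsum)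

/-- For a null solution, `x (k+1) - r x k` is itself null with increments of size `‖r e x‖`, so it
is bounded by the tail of `∑ ‖e‖` times the supremum of `‖x‖` from `k` on. Once the tail is below `s
- ‖r‖`, that supremum shrinks by a factor `s` at each step. -/
lemma IsSol.isBigO_of_tendsto_zero (hx : IsSol r e x) (hr : ‖r‖ < 1)
    (he : Summable fun k => ‖e k‖) (h0 : Tendsto x atTop (𝓝 0)) {s : ℝ} (hs : ‖r‖ < s) :
    x =O[atTop] fun n => s ^ n := by
  have hs0 : 0 < s := (norm_nonneg r).trans_lt hs
  have key : ∀ B k, (∀ j, ‖x (j + k)‖ ≤ B) →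
      ‖x (k + 1) - r * x k‖ ≤ (∑' j, ‖e (j + k)‖) * B := by
    intro B k hB
    set z : ℕ → 𝕜 := fun j => x (j + k + 1) - r * x (j + k) with hz
    have hz0 : Tendsto z atTop (𝓝 0) := by
      have h1 : Tendsto (fun j => x (j + k + 1)) atTop (𝓝 0) :=
        (tendsto_add_atTop_iff_nat (f := x) (k + 1)).2 h0
      have h2 : Tendsto (fun j => x (j + k)) atTop (𝓝 0) := (tendsto_add_atTop_iff_nat k).2 h0
      simpa using h1.sub (h2.const_mul r)
    have hsum : Summable fun j => ‖e (j + k)‖ * B := ((summable_nat_add_iff k).2 he).mul_right B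
    have := dist_le_tsum_of_dist_le_of_tendsto₀ (f := z) (a := 0) (fun j => ‖e (j + k)‖ * B)
      (fun j => ?_) hsum hz0
    · rw [tsum_mul_right] at this
      simpa [hz] using this
    · have e1 : z j - z j.succ = r * (e (j + k) * x (j + k)) := by
        simp only [hz, Nat.succ_eq_add_one, show j + 1 + k = j + k + 1 by ring]
        rw [show j + k + 1 + 1 = j + k + 2 by ring, hx (j + k)]; ring
      rw [dist_eq_norm, e1, norm_mul, norm_mul]
      calc ‖r‖ * (‖e (j + k)‖ * ‖x (j + k)‖) ≤ ‖e (j + k)‖ * ‖x (j + k)‖ :=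
            mul_le_of_le_one_left (by positivity) hr.le
        _ ≤ _ := by gcongr; exact hB j
  have htail : ∀ᶠ k in atTop, ∑' j, ‖e (j + k)‖ < s - ‖r‖ :=
    (tendsto_sum_nat_add fun k => ‖e k‖).eventually (gt_mem_nhds (by linarith))
  obtain ⟨N, hN⟩ := eventually_atTop.1 htail
  obtain ⟨B, -, hB⟩ := hx.bounded hr he
  have hind : ∀ j i, ‖x (i + (N + j))‖ ≤ s ^ j * B := by
    intro j
    induction j with
    | zero => intro i; simpa using hB _
    | succ j ih =>
      intro i
      have h1 := key (s ^ j * B) (i + (N + j)) (fun l => by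
        have := ih (l + i); rwa [add_assoc] at this)
      have h2 := hN (i + (N + j)) (by omega)
      have h3 := ih i
      have h4 : 0 ≤ s ^ j * B := (norm_nonneg _).trans h3
      have h5 : ‖x (i + (N + j) + 1)‖ ≤ ‖x (i + (N + j) + 1) - r * x (i + (N + j))‖
          + ‖r‖ * ‖x (i + (N + j))‖ := by
        rw [← norm_mul]
        simpa using norm_add_le (x (i + (N + j) + 1) - r * x (i + (N + j))) (r * x (i + (N + j)))
      rw [show i + (N + (j + 1)) = i + (N + j) + 1 by ring]
      calc _ ≤ _ := h5
        _ ≤ (s - ‖r‖) * (s ^ j * B) + ‖r‖ * (s ^ j * B) := by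
          refine add_le_add (h1.trans ?_) ?_ <;> gcongr
        _ = _ := by rw [pow_succ]; ring
  refine IsBigO.of_bound (B * (s ^ N)⁻¹) (eventually_atTop.2 ⟨N, fun n hn => ?_⟩)
  obtain ⟨j, rfl⟩ := Nat.exists_eq_add_of_le hn
  have := hind j 0
  rw [zero_add] at this
  rw [Real.norm_of_nonneg (by positivity), pow_add]
  calc _ ≤ _ := this
    _ = _ := by field_simp

/-- The Casoratian of two solutions. -/
lemma IsSol.casoratian (hx : IsSol r e x) (hy : IsSol r e y) (n : ℕ) :
    x (n + 1) * y n - x n * y (n + 1) =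
      r ^ n * (∏ j ∈ Finset.range n, (1 + e j)) * (x 1 * y 0 - x 0 * y 1) := by
  induction n with
  | zero => simp
  | succ n ih =>
    rw [Finset.prod_range_succ, pow_succ]
    have : x (n + 1 + 1) * y (n + 1) - x (n + 1) * y (n + 1 + 1) =
        r * (1 + e n) * (x (n + 1) * y n - x n * y (n + 1)) := by
      rw [hx n, hy n]; ring
    rw [this, ih]; ring

/-- Two solutions tending to zero are proportional. -/
lemma IsSol.proportional_of_tendsto_zero (hx : IsSol r e x) (hy : IsSol r e y) (hr : ‖r‖ < 1)
    (hr0 : r ≠ 0) (he : Summable fun k => ‖e k‖) (he1 : ∀ k, 1 ≤ ‖1 + e k‖)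
    (hx0 : Tendsto x atTop (𝓝 0)) (hy0 : Tendsto y atTop (𝓝 0)) : x 1 * y 0 = x 0 * y 1 := by
  by_contra hne
  have hw : x 1 * y 0 - x 0 * y 1 ≠ 0 := sub_ne_zero.2 hne
  have hrpos : 0 < ‖r‖ := norm_pos_iff.2 hr0
  -- Chosen so that `‖r‖² < s² < ‖r‖`: both solutions are `O(s^n)`, making the Casoratian `O(s^(2n))
  -- = o(‖r‖^n)`, whereas it is bounded below by a multiple of `‖r‖^n`.
  set s := Real.sqrt ((‖r‖ + ‖r‖ ^ 2) / 2) with hs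
  have hs2 : s * s = (‖r‖ + ‖r‖ ^ 2) / 2 := Real.mul_self_sqrt (by positivity)
  have hs0 : 0 < s := Real.sqrt_pos.2 (by positivity)
  have hrs : ‖r‖ < s := Real.lt_sqrt_of_sq_lt (by nlinarith)
  have hsr : s * s < ‖r‖ := by nlinarith
  have hX := hx.isBigO_of_tendsto_zero hr he hx0 hrs
  have hY := hy.isBigO_of_tendsto_zero hr he hy0 hrs
  have hsh : (fun n : ℕ => s ^ (n + 1)) =O[atTop] fun n : ℕ => s ^ n := by
    simp_rw [pow_succ, mul_comm _ s]
    exact isBigO_const_mul_self s _ _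
  have hX1 : (fun n => x (n + 1)) =O[atTop] fun n : ℕ => s ^ n :=
    (hX.comp_tendsto (tendsto_add_atTop_nat 1)).trans hsh
  have hY1 : (fun n => y (n + 1)) =O[atTop] fun n : ℕ => s ^ n :=
    (hY.comp_tendsto (tendsto_add_atTop_nat 1)).trans hsh
  have hW : (fun n => x (n + 1) * y n - x n * y (n + 1)) =O[atTop] fun n : ℕ => (s * s) ^ n := by
    simp_rw [mul_pow]
    exact (hX1.mul hY).sub (hX.mul hY1)
  have hlt : (fun n : ℕ => (s * s) ^ n) =o[atTop] fun n : ℕ => ‖r‖ ^ n :=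
    isLittleO_pow_pow_of_lt_left (by positivity) hsr
  have hbig : (fun n : ℕ => ‖r‖ ^ n) =O[atTop]
      fun n => x (n + 1) * y n - x n * y (n + 1) := by
    refine IsBigO.of_bound ‖x 1 * y 0 - x 0 * y 1‖⁻¹ (Eventually.of_forall fun n => ?_)
    rw [hx.casoratian hy n, norm_mul, norm_mul, norm_prod, norm_pow, norm_pow, norm_norm]
    have h1 : 1 ≤ ∏ j ∈ Finset.range n, ‖1 + e j‖ :=
      Finset.one_le_prod fun j _ => he1 j
    have h2 : ‖x 1 * y 0 - x 0 * y 1‖ ≠ 0 := norm_ne_zero_iff.2 hw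
    rw [mul_comm, mul_assoc, mul_assoc, mul_inv_cancel₀ h2, mul_one]
    exact le_mul_of_one_le_right (by positivity) h1
  have hcontra := (hW.trans_isLittleO hlt).trans_isBigO hbig
  refine isLittleO_irrefl (Eventually.frequently (Eventually.of_forall fun n => ?_)) hcontra
  rw [hx.casoratian hy]
  have : ∀ j, 1 + e j ≠ 0 := fun j => norm_pos_iff.1 (one_pos.trans_le (he1 j))
  exact mul_ne_zero (mul_ne_zero (pow_ne_zero _ hr0) (Finset.prod_ne_zero_iff.2 fun j _ => this j)) hw

/-- If the increments of a null sequence are asymptotic to `c r ^ k`, the sequence is asymptotic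
to the corresponding geometric tail. -/
lemma tendsto_div_pow_of_increments {r c : ℝ} {h : ℕ → ℝ} (hr : |r| < 1) (hr0 : r ≠ 0)
    (h0 : Tendsto h atTop (𝓝 0))
    (hinc : Tendsto (fun k => (h (k + 1) - h k) / r ^ k) atTop (𝓝 c)) :
    Tendsto (fun k => h k / r ^ k) atTop (𝓝 (-c / (1 - r))) := by
  have hr1 : 0 < 1 - |r| := by linarith
  have hr1' : 1 - r ≠ 0 := by have := le_abs_self r; linarith
  have hrp : 0 < |r| := abs_pos.2 hr0
  -- Subtracting the expected geometric tail `-c/(1-r) r^k` leaves a null sequence with increments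
  -- `o(r^k)`.
  set g : ℕ → ℝ := fun k => h k + c / (1 - r) * r ^ k with hg
  have hg0 : Tendsto g atTop (𝓝 0) := by
    simpa using h0.add ((tendsto_pow_atTop_nhds_zero_of_abs_lt_one hr).const_mul (c / (1 - r)))
  rw [Metric.tendsto_atTop] at hinc ⊢
  intro η hη
  obtain ⟨N, hN⟩ := hinc (η / 2 * (1 - |r|)) (by positivity)
  refine ⟨N, fun n hn => ?_⟩
  have hstep : ∀ k, dist (g (k + n)) (g (k + 1 + n)) ≤ (η / 2 * (1 - |r|) * |r| ^ n) * |r| ^ k := by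
    intro k
    have h1 := hN (k + n) (by omega)
    rw [Real.dist_eq] at h1
    have hrk : r ^ (k + n) ≠ 0 := pow_ne_zero _ hr0
    have h2 : g (k + 1 + n) - g (k + n) =
        ((h (k + n + 1) - h (k + n)) / r ^ (k + n) - c) * r ^ (k + n) := by
      simp only [hg, show k + 1 + n = k + n + 1 by ring, pow_succ]
      field_simp; ring
    rw [dist_comm, Real.dist_eq, h2, abs_mul, abs_pow, pow_add]
    calc _ ≤ (η / 2 * (1 - |r|)) * |r| ^ (k + n) := by rw [← pow_add]; gcongr
      _ = (η / 2 * (1 - |r|)) * (|r| ^ k * |r| ^ n) := by rw [pow_add]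
      _ = _ := by ring
  have h3 := dist_le_of_le_geometric_of_tendsto₀ |r| (η / 2 * (1 - |r|) * |r| ^ n) (by linarith)
    hstep ((tendsto_add_atTop_iff_nat n).2 hg0)
  have hrn : r ^ n ≠ 0 := pow_ne_zero _ hr0
  rw [zero_add, dist_zero_right, Real.norm_eq_abs] at h3
  have h4 : h n / r ^ n - -c / (1 - r) = g n / r ^ n := by
    simp only [hg]; field_simp; ring
  rw [Real.dist_eq, h4, abs_div, abs_pow, div_lt_iff₀ (by positivity)]
  calc _ ≤ _ := h3
    _ = η / 2 * |r| ^ n := by field_simp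
    _ < η * |r| ^ n := by gcongr; linarith

/-- The rate at which the quotient of two solutions converges. -/
lemma IsSol.tendsto_sub_div_pow {r : ℝ} {e p q : ℕ → ℝ} (hp : IsSol r e p) (hq : IsSol r e q)
    (hr : |r| < 1) (hr0 : r ≠ 0) (he : Summable e) (he0 : ∀ k, 0 ≤ e k) {a b : ℝ}
    (hpa : Tendsto p atTop (𝓝 a)) (hqb : Tendsto q atTop (𝓝 b)) (hb : b ≠ 0)
    (hw : p 1 * q 0 - p 0 * q 1 ≠ 0) :
    ∃ c : ℝ, c ≠ 0 ∧ Tendsto (fun k => (a / b - p k / q k) / r ^ k) atTop (𝓝 c) := by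
  have hprod := (Real.multipliable_one_add_of_summable he).hasProd.tendsto_prod_nat
  set P := ∏' j, (1 + e j)
  have hP : 1 ≤ P := ge_of_tendsto' hprod fun n =>
    Finset.one_le_prod fun j _ => by linarith [he0 j]
  have hr1' : 1 - r ≠ 0 := by have := le_abs_self r; linarith
  have hq' : ∀ᶠ k in atTop, q k ≠ 0 := hqb.eventually_ne hb
  have hq1 : ∀ᶠ k in atTop, q (k + 1) ≠ 0 := (tendsto_add_atTop_nat 1).eventually hq'
  set w := p 1 * q 0 - p 0 * q 1
  have h0 : Tendsto (fun k => p k / q k - a / b) atTop (𝓝 0) := by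
    simpa using (hpa.div hqb hb).sub_const (a / b)
  -- The increment of `p/q` is the Casoratian over `q k * q (k+1)`.
  have hinc : Tendsto (fun k => ((p (k + 1) / q (k + 1) - a / b) - (p k / q k - a / b)) / r ^ k)
      atTop (𝓝 (P * w / (b * b))) := by
    refine ((hprod.mul_const w).div (hqb.mul (hqb.comp (tendsto_add_atTop_nat 1)))
      (mul_ne_zero hb hb)).congr' ?_
    filter_upwards [hq', hq1] with k h1 h2
    have h3 := hp.casoratian hq k
    have h4 : r ^ k ≠ 0 := pow_ne_zero _ hr0
    simp only [Function.comp, Pi.div_apply]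
    rw [div_eq_div_iff (mul_ne_zero h1 h2) h4]
    have : (p (k + 1) / q (k + 1) - a / b - (p k / q k - a / b)) * (q k * q (k + 1)) =
        p (k + 1) * q k - p k * q (k + 1) := by field_simp; ring
    rw [this, h3]; ring
  have := (tendsto_div_pow_of_increments hr hr0 h0 hinc).neg
  refine ⟨_, ?_, this.congr fun k => ?_⟩
  · have : P ≠ 0 := by linarith
    rw [neg_div, neg_neg]
    positivity
  · rw [← neg_div, neg_sub]

end PerturbedRecurrence

/-! ### Integral representations of the Gauss hypergeometric function -/

namespace ContFracT

open MeasureTheory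

lemma isOpen_cutPlane : IsOpen cutPlane :=
  (isOpen_lt Complex.continuous_re continuous_const).union
    (isOpen_ne_fun Complex.continuous_im continuous_const)

lemma zero_mem_cutPlane : (0 : ℂ) ∈ cutPlane := Or.inl (by simp)

lemma isPreconnected_cutPlane : IsPreconnected cutPlane := by
  have : StarConvex ℝ (0 : ℂ) cutPlane := by
    rw [starConvex_zero_iff]
    rintro x hx t ht0 ht1
    simp only [cutPlane, Set.mem_ofPred_eq, Complex.smul_re, Complex.smul_im, smul_eq_mul] at hx ⊢
    rcases ht0.eq_or_lt with rfl | ht0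
    · left; simp
    · refine hx.imp (fun h => ?_) (fun h => mul_ne_zero ht0.ne' h)
      nlinarith
  exact (this.isPathConnected zero_mem_cutPlane).isConnected.isPreconnected

lemma IsHypergeometricContinuation.eqOn {a b c : ℂ} {F G : ℂ → ℂ}
    (hF : IsHypergeometricContinuation a b c F) (hG : IsHypergeometricContinuation a b c G) :
    Set.EqOn F G cutPlane := by
  refine hF.1.eqOn_of_preconnected_of_eventuallyEq hG.1 isPreconnected_cutPlane
    zero_mem_cutPlane ?_
  filter_upwards [Metric.ball_mem_nhds (0 : ℂ) one_pos] with x hx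
  rw [mem_ball_zero_iff] at hx
  rw [hF.2 x hx, hG.2 x hx]

/-- Lets any explicit continuation, here an integral, replace the branch obtained by choice. -/
lemma IsHypergeometricContinuation.hyp2F1_eq {a b c x : ℂ} {F : ℂ → ℂ}
    (hF : IsHypergeometricContinuation a b c F) (hx : x ∈ cutPlane) : hyp2F1 a b c x = F x := by
  have h : ∃ F, IsHypergeometricContinuation a b c F := ⟨F, hF⟩
  rw [hyp2F1, dif_pos h]
  exact h.choose_spec.eqOn hF hx

/-- The kernel `1 - x sin² φ`. -/
noncomputable def kernel (x : ℂ) (φ : ℝ) : ℂ := 1 - x * (Real.sin φ : ℂ) ^ 2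

lemma kernel_mem_slitPlane {x : ℂ} (hx : x ∈ cutPlane) (φ : ℝ) :
    kernel x φ ∈ Complex.slitPlane := by
  have h0 : 0 ≤ Real.sin φ ^ 2 := sq_nonneg _
  have h1 : Real.sin φ ^ 2 ≤ 1 := Real.sin_sq_le_one φ
  have hk : kernel x φ = 1 - x * ((Real.sin φ ^ 2 : ℝ) : ℂ) := by simp [kernel]
  rw [hk, Complex.mem_slitPlane_iff]
  simp only [Complex.sub_re, Complex.one_re, Complex.re_mul_ofReal, Complex.sub_im, Complex.one_im,
    Complex.im_mul_ofReal, zero_sub, ne_eq, neg_eq_zero, mul_eq_zero, not_or]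
  rcases h0.eq_or_lt with h | h
  · left; rw [← h]; simp
  · refine hx.imp (fun hx => ?_) (fun hx => ⟨hx, h.ne'⟩)
    nlinarith

lemma kernel_ne_zero {x : ℂ} (hx : x ∈ cutPlane) (φ : ℝ) : kernel x φ ≠ 0 :=
  Complex.slitPlane_ne_zero (kernel_mem_slitPlane hx φ)

lemma continuous_kernel_cpow {x : ℂ} (hx : x ∈ cutPlane) (s : ℂ) :
    Continuous fun φ => kernel x φ ^ s := by
  refine Continuous.cpow ?_ continuous_const (kernel_mem_slitPlane hx)
  unfold kernel; fun_prop

/-- Differentiation under the integral sign; the derivative is dominated by a constant, by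
compactness of a closed ball times `[0, π]`. -/
lemma analyticOnNhd_integral_kernel {w : ℝ → ℂ} (hw : Continuous w) (s : ℂ) :
    AnalyticOnNhd ℂ (fun x => ∫ φ in (0 : ℝ)..Real.pi, w φ * kernel x φ ^ s) cutPlane := by
  refine DifferentiableOn.analyticOnNhd (fun x hx => ?_) isOpen_cutPlane
  obtain ⟨ε, hε, hball⟩ := Metric.nhds_basis_closedBall.mem_iff.1 (isOpen_cutPlane.mem_nhds hx)
  set F' : ℂ → ℝ → ℂ := fun y φ =>
    w φ * (s * kernel y φ ^ (s - 1) * (-(Real.sin φ : ℂ) ^ 2)) with hF'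
  have hcont : ContinuousOn (fun z : ℂ × ℝ => F' z.1 z.2)
      (Metric.closedBall x ε ×ˢ Set.uIcc 0 Real.pi) := by
    have hk : ContinuousOn (fun z : ℂ × ℝ => kernel z.1 z.2 ^ (s - 1))
        (Metric.closedBall x ε ×ˢ Set.uIcc 0 Real.pi) := by
      refine ContinuousOn.cpow_const ?_ fun z hz => kernel_mem_slitPlane (hball hz.1) _
      unfold kernel; fun_prop
    have hsin : Continuous fun z : ℂ × ℝ => -(Real.sin z.2 : ℂ) ^ 2 := by fun_prop
    exact (hw.comp continuous_snd).continuousOn.mul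
      ((continuousOn_const.mul hk).mul hsin.continuousOn)
  obtain ⟨M, hM⟩ := ((isCompact_closedBall x ε).prod isCompact_uIcc).exists_bound_of_continuousOn
    hcont
  have hcont1 : ∀ y ∈ cutPlane, Continuous fun φ => w φ * kernel y φ ^ s := fun y hy =>
    hw.mul (continuous_kernel_cpow hy s)
  have := intervalIntegral.hasDerivAt_integral_of_dominated_loc_of_deriv_le
    (μ := volume) (a := 0) (b := Real.pi)
    (F := fun y φ => w φ * kernel y φ ^ s) (F' := F') (x₀ := x) (bound := fun _ => M)
    (Metric.closedBall_mem_nhds x hε)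
    (by
      filter_upwards [isOpen_cutPlane.mem_nhds hx] with y hy
      exact (hcont1 y hy).aestronglyMeasurable)
    ((hcont1 x hx).intervalIntegrable _ _)
    (by
      have : Continuous (F' x) := hw.mul ((continuous_const.mul
        (continuous_kernel_cpow hx (s - 1))).mul (by fun_prop))
      exact this.aestronglyMeasurable)
    (Eventually.of_forall fun t ht y hy => hM (y, t) ⟨hy, Set.uIoc_subset_uIcc ht⟩)
    intervalIntegrable_const
    (Eventually.of_forall fun t _ y hy => by
      have h1 : HasDerivAt (fun y => kernel y t) (-(Real.sin t : ℂ) ^ 2) y := by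
        unfold kernel
        simpa using ((hasDerivAt_id y).mul_const ((Real.sin t : ℂ) ^ 2)).const_sub 1
      exact (h1.cpow_const (kernel_mem_slitPlane (hball hy) t)).const_mul (w t))
  exact this.2.differentiableAt.differentiableWithinAt

/-! ### Termwise integration of the binomial series and Wallis moments -/

lemma hasSum_one_sub_cpow (b : ℂ) {y : ℂ} (hy : ‖y‖ < 1) :
    HasSum (fun n : ℕ => (ascPochhammer ℂ n).eval b / n.factorial * y ^ n) ((1 - y) ^ (-b)) ∧
    Summable fun n : ℕ => ‖(ascPochhammer ℂ n).eval b / n.factorial * y ^ n‖ := by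
  have hF := Complex.one_div_one_sub_cpow_hasFPowerSeriesOnBall_zero b
  have hmem : y ∈ Metric.eball (0 : ℂ) 1 := by
    rw [← ENNReal.ofReal_one, Metric.eball_ofReal]; simpa using hy
  have hcoef : ∀ n : ℕ, Ring.choose (b + n - 1) n = (ascPochhammer ℂ n).eval b / n.factorial := by
    intro n
    rw [← Ring.multichoose_eq, eq_div_iff (by exact_mod_cast n.factorial_ne_zero), mul_comm,
      ← nsmul_eq_mul, Ring.factorial_nsmul_multichoose_eq_ascPochhammer,
      Polynomial.ascPochhammer_smeval_eq_eval]
  constructor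
  · have := hF.hasSum hmem
    simp only [FormalMultilinearSeries.ofScalars_apply_eq, zero_add, smul_eq_mul, hcoef] at this
    rwa [one_div, ← Complex.cpow_neg] at this
  · have := FormalMultilinearSeries.summable_norm_apply _ (Metric.eball_subset_eball hF.r_le hmem)
    simpa only [FormalMultilinearSeries.ofScalars_apply_eq, smul_eq_mul, hcoef] using this

lemma hasSum_integral_kernel {w : ℝ → ℂ} (hw : Continuous w) (hw1 : ∀ φ, ‖w φ‖ ≤ 1) (b : ℂ)
    {x : ℂ} (hx : ‖x‖ < 1) :
    HasSum (fun n : ℕ => (∫ φ in (0 : ℝ)..Real.pi, w φ * (Real.sin φ : ℂ) ^ (2 * n)) *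
        ((ascPochhammer ℂ n).eval b / n.factorial) * x ^ n)
      (∫ φ in (0 : ℝ)..Real.pi, w φ * kernel x φ ^ (-b)) := by
  have hsin : ∀ φ : ℝ, ‖(Real.sin φ : ℂ) ^ 2‖ ≤ 1 := fun φ => by
    rw [norm_pow, Complex.norm_real, Real.norm_eq_abs, sq_abs]; exact Real.sin_sq_le_one φ
  have hlt : ∀ φ : ℝ, ‖x * (Real.sin φ : ℂ) ^ 2‖ < 1 := fun φ => by
    rw [norm_mul]
    exact (mul_le_of_le_one_right (norm_nonneg _) (hsin φ)).trans_lt hx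
  have := intervalIntegral.hasSum_integral_of_dominated_convergence (μ := volume)
    (a := 0) (b := Real.pi)
    (F := fun (n : ℕ) φ => w φ * ((ascPochhammer ℂ n).eval b / n.factorial *
      (x * (Real.sin φ : ℂ) ^ 2) ^ n))
    (f := fun φ => w φ * kernel x φ ^ (-b))
    (fun n _ => ‖(ascPochhammer ℂ n).eval b / n.factorial * x ^ n‖)
    (fun n => Continuous.aestronglyMeasurable (hw.mul (by fun_prop)))
    (fun n => Eventually.of_forall fun φ _ => by
      rw [norm_mul, mul_pow, ← mul_assoc, norm_mul, norm_pow _ n]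
      have := pow_le_one₀ (n := n) (norm_nonneg _) (hsin φ)
      calc _ ≤ 1 * (‖(ascPochhammer ℂ n).eval b / n.factorial * x ^ n‖ * 1) := by
            gcongr
            exact hw1 φ
        _ = _ := by ring)
    (Eventually.of_forall fun _ _ => (hasSum_one_sub_cpow b hx).2)
    intervalIntegrable_const
    (Eventually.of_forall fun φ _ => ((hasSum_one_sub_cpow b (hlt φ)).1).mul_left (w φ))
  refine (congrArg (fun f : ℕ → ℂ => HasSum f _) (funext fun n => ?_)).mpr this
  rw [mul_assoc, ← intervalIntegral.integral_mul_const]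
  refine intervalIntegral.integral_congr fun φ _ => ?_
  ring

lemma integral_sin_pow_even_succ (n : ℕ) :
    (∫ φ in (0 : ℝ)..Real.pi, Real.sin φ ^ (2 * (n + 1))) =
      (2 * n + 1) / (2 * n + 2) * ∫ φ in (0 : ℝ)..Real.pi, Real.sin φ ^ (2 * n) := by
  rw [integral_sin_pow_even, integral_sin_pow_even, Finset.prod_range_succ]; ring

lemma integral_sin_pow_even_eq (n : ℕ) :
    ((∫ φ in (0 : ℝ)..Real.pi, Real.sin φ ^ (2 * n) : ℝ) : ℂ) =
      Real.pi * ((ascPochhammer ℂ n).eval (1 / 2) / (ascPochhammer ℂ n).eval 1) := by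
  induction n with
  | zero => simp
  | succ n ih =>
    rw [integral_sin_pow_even_succ, Complex.ofReal_mul, ih, ascPochhammer_succ_eval,
      ascPochhammer_succ_eval, ascPochhammer_eval_one]
    have h1 : (n.factorial : ℂ) ≠ 0 := by exact_mod_cast n.factorial_ne_zero
    have h2 : (n : ℂ) + 1 ≠ 0 := by exact_mod_cast n.succ_ne_zero
    have h3 : (1 : ℂ) + n ≠ 0 := by rwa [add_comm]
    have h4 : 2 * (n : ℂ) + 2 ≠ 0 := by
      rw [show 2 * (n : ℂ) + 2 = 2 * (n + 1) by ring]; exact mul_ne_zero two_ne_zero h2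
    push_cast
    field_simp
    ring

/-- Since `sin²(2φ) = 4 (sin²φ - sin⁴φ)`, this reduces to Wallis integrals. -/
lemma integral_sin_two_mul_sq_mul_sin_pow (n : ℕ) :
    ((∫ φ in (0 : ℝ)..Real.pi, Real.sin (2 * φ) ^ 2 * Real.sin φ ^ (2 * n) : ℝ) : ℂ) =
      Real.pi / 2 * ((ascPochhammer ℂ n).eval (3 / 2) / (ascPochhammer ℂ n).eval 3) := by
  have hJ : ∀ m : ℕ, IntervalIntegrable (fun φ => Real.sin φ ^ (2 * m)) volume 0 Real.pi :=
    fun m => Continuous.intervalIntegrable (by fun_prop) _ _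
  have h1 : ∀ n : ℕ, (∫ φ in (0 : ℝ)..Real.pi, Real.sin (2 * φ) ^ 2 * Real.sin φ ^ (2 * n)) =
      2 / (n + 2) * ∫ φ in (0 : ℝ)..Real.pi, Real.sin φ ^ (2 * (n + 1)) := by
    intro n
    have e1 : ∀ φ : ℝ, Real.sin (2 * φ) ^ 2 * Real.sin φ ^ (2 * n) =
        4 * (Real.sin φ ^ (2 * (n + 1)) - Real.sin φ ^ (2 * (n + 1 + 1))) := by
      intro φ
      rw [Real.sin_two_mul, mul_pow, Real.cos_sq']
      ring
    simp_rw [e1]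
    rw [intervalIntegral.integral_const_mul, intervalIntegral.integral_sub (hJ _) (hJ _),
      integral_sin_pow_even_succ (n + 1)]
    push_cast
    have : (n : ℝ) + 2 ≠ 0 := by positivity
    have : 2 * ((n : ℝ) + 1) + 2 ≠ 0 := by positivity
    field_simp
    ring
  induction n with
  | zero =>
    rw [h1 0, integral_sin_pow_even_succ]
    simp [inv_mul_eq_div]
  | succ n ih =>
    have h2 : (n : ℂ) + 2 ≠ 0 := by exact_mod_cast (n + 1).succ_ne_zero
    have h3 : (n : ℂ) + 3 ≠ 0 := by exact_mod_cast (n + 2).succ_ne_zero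
    have h3' : (3 : ℂ) + n ≠ 0 := by rwa [add_comm]
    rw [h1, integral_sin_pow_even_succ, ascPochhammer_succ_eval, ascPochhammer_succ_eval]
    rw [h1] at ih
    have h4 : ∀ t : ℝ, 2 / (((n + 1 : ℕ) : ℝ) + 2) * ((2 * ((n + 1 : ℕ) : ℝ) + 1) /
        (2 * ((n + 1 : ℕ) : ℝ) + 2) * t) = (3 / 2 + n) / (3 + n) * (2 / (n + 2) * t) := by
      intro t
      push_cast
      have : (n : ℝ) + 2 ≠ 0 := by positivity
      have : (3 : ℝ) + n ≠ 0 := by positivity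
      have : 2 * ((n : ℝ) + 1) + 2 ≠ 0 := by positivity
      have : (n : ℝ) + 1 + 2 ≠ 0 := by positivity
      field_simp
      ring
    rw [h4, Complex.ofReal_mul, ih]
    push_cast
    field_simp

/-- Euler's integral with `t = sin²φ`, where `t^(-1/2) (1-t)^(-1/2) dt` becomes `2 dφ` and the
endpoint singularities disappear. -/
lemma isHypergeometricContinuation_half (b : ℂ) :
    IsHypergeometricContinuation (1 / 2) b 1
      (fun x => 1 / Real.pi * ∫ φ in (0 : ℝ)..Real.pi, 1 * kernel x φ ^ (-b)) := by
  have hpi : (Real.pi : ℂ) ≠ 0 := by exact_mod_cast Real.pi_ne_zero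
  refine ⟨fun x hx => analyticAt_const.mul (analyticOnNhd_integral_kernel continuous_const _ x hx),
    fun x hx => ?_⟩
  rw [ordinaryHypergeometric, ordinaryHypergeometric_sum_eq]
  refine (((hasSum_integral_kernel (w := fun _ => 1) continuous_const (by simp) b hx).mul_left
    (1 / (Real.pi : ℂ))).tsum_eq.symm).trans (tsum_congr fun n => ?_)
  have h1 : (∫ φ in (0 : ℝ)..Real.pi, 1 * (Real.sin φ : ℂ) ^ (2 * n)) =
      ((∫ φ in (0 : ℝ)..Real.pi, Real.sin φ ^ (2 * n) : ℝ) : ℂ) := by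
    rw [← intervalIntegral.integral_ofReal]; simp
  rw [h1, integral_sin_pow_even_eq, smul_eq_mul]
  field_simp

/-- The same substitution turns `t^(1/2) (1-t)^(1/2) dt` into `sin²(2φ)/2 dφ`. -/
lemma isHypergeometricContinuation_three_halves (b : ℂ) :
    IsHypergeometricContinuation (3 / 2) b 3
      (fun x => 2 / Real.pi * ∫ φ in (0 : ℝ)..Real.pi,
        (Real.sin (2 * φ) ^ 2 : ℝ) * kernel x φ ^ (-b)) := by
  have hpi : (Real.pi : ℂ) ≠ 0 := by exact_mod_cast Real.pi_ne_zero
  have hc : Continuous fun φ : ℝ => ((Real.sin (2 * φ) ^ 2 : ℝ) : ℂ) := by fun_prop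
  refine ⟨fun x hx => analyticAt_const.mul (analyticOnNhd_integral_kernel hc _ x hx),
    fun x hx => ?_⟩
  rw [ordinaryHypergeometric, ordinaryHypergeometric_sum_eq]
  refine (((hasSum_integral_kernel hc (fun φ => ?_) b hx).mul_left
    (2 / (Real.pi : ℂ))).tsum_eq.symm).trans (tsum_congr fun n => ?_)
  · rw [Complex.norm_real, Real.norm_of_nonneg (sq_nonneg _)]
    exact Real.sin_sq_le_one _
  have h1 : (∫ φ in (0 : ℝ)..Real.pi, ((Real.sin (2 * φ) ^ 2 : ℝ) : ℂ) * (Real.sin φ : ℂ) ^ (2 * n))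
      = ((∫ φ in (0 : ℝ)..Real.pi, Real.sin (2 * φ) ^ 2 * Real.sin φ ^ (2 * n) : ℝ) : ℂ) := by
    rw [← intervalIntegral.integral_ofReal]; simp
  rw [h1, integral_sin_two_mul_sq_mul_sin_pow, smul_eq_mul]
  field_simp

end ContFracT

/-! ### Fourier coefficients of powers of the kernel, and their relation to `T₀` and `T₁` -/

namespace ContFracT

open MeasureTheory

/-- The Fourier coefficients `∫₀^π cos (2nφ) (1 - x sin² φ)^(-b) dφ` of a power of the kernel. -/
noncomputable def fourierKernel (b x : ℂ) (n : ℕ) : ℂ :=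
  ∫ φ in (0 : ℝ)..Real.pi, (Real.cos (2 * n * φ) : ℂ) * kernel x φ ^ (-b)

lemma kernel_eq (x : ℂ) (φ : ℝ) :
    kernel x φ = (1 - x / 2) + x / 2 * (Real.cos (2 * φ) : ℂ) := by
  rw [kernel, Real.cos_two_mul, Real.cos_sq']
  push_cast
  ring

lemma hasDerivAt_kernel (x : ℂ) (φ : ℝ) :
    HasDerivAt (kernel x) (-x * (Real.sin (2 * φ) : ℂ)) φ := by
  have h := ((Real.hasDerivAt_sin φ).ofReal_comp.pow 2).const_mul x |>.const_sub 1
  refine h.congr_deriv ?_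
  rw [Real.sin_two_mul]
  push_cast
  ring

/-- The integrand is the derivative of `sin(2nφ) (1 - x sin²φ)^s`, which vanishes at both endpoints.
The case `s = -b`, `n = 1` gives the first coefficient; `s = 1 - b` gives the recurrence. -/
lemma integral_deriv_sin_mul_kernel {x : ℂ} (hx : x ∈ cutPlane) (s : ℂ) (n : ℕ) :
    ∫ φ in (0 : ℝ)..Real.pi, (2 * n * (Real.cos (2 * n * φ) : ℂ) * kernel x φ ^ s +
      (Real.sin (2 * n * φ) : ℂ) *
        (s * kernel x φ ^ (s - 1) * (-x * (Real.sin (2 * φ) : ℂ)))) = 0 := by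
  have hd : ∀ φ : ℝ, HasDerivAt (fun φ : ℝ => (Real.sin (2 * n * φ) : ℂ) * kernel x φ ^ s)
      (2 * n * (Real.cos (2 * n * φ) : ℂ) * kernel x φ ^ s + (Real.sin (2 * n * φ) : ℂ) *
        (s * kernel x φ ^ (s - 1) * (-x * (Real.sin (2 * φ) : ℂ)))) φ := by
    intro φ
    have h1 : HasDerivAt (fun φ : ℝ => (Real.sin (2 * n * φ) : ℂ))
        (2 * n * (Real.cos (2 * n * φ) : ℂ)) φ := by
      have := (((hasDerivAt_id φ).const_mul (2 * (n : ℝ))).sin).ofReal_comp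
      refine this.congr_deriv ?_
      simp [mul_comm]
    have h2 : HasDerivAt (fun φ : ℝ => kernel x φ ^ s)
        (s * kernel x φ ^ (s - 1) * (-x * (Real.sin (2 * φ) : ℂ))) φ := by
      have h3 : HasDerivAt (fun z : ℂ => z ^ s) (s * kernel x φ ^ (s - 1)) (kernel x φ) := by
        simpa using (hasDerivAt_id (kernel x φ)).cpow_const (c := s) (kernel_mem_slitPlane hx φ)
      exact h3.comp φ (hasDerivAt_kernel x φ)
    exact h1.mul h2
  have hk := continuous_kernel_cpow hx s
  have hk1 := continuous_kernel_cpow hx (s - 1)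
  rw [intervalIntegral.integral_eq_sub_of_hasDerivAt (fun φ _ => hd φ)]
  · have : Real.sin (2 * n * Real.pi) = 0 := by
      exact_mod_cast Real.sin_nat_mul_pi (2 * n)
    simp [this]
  · exact Continuous.intervalIntegrable (by fun_prop) _ _

lemma fourierKernel_one {b x : ℂ} (hx : x ∈ cutPlane) :
    fourierKernel b x 1 = -(b * x / 2) * ∫ φ in (0 : ℝ)..Real.pi,
      ((Real.sin (2 * φ) ^ 2 : ℝ) : ℂ) * kernel x φ ^ (-(b + 1)) := by
  have h := integral_deriv_sin_mul_kernel hx (-b) 1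
  have hk := continuous_kernel_cpow hx (-b)
  have hk1 := continuous_kernel_cpow hx (-(b + 1))
  have e : ∀ φ : ℝ, (2 * ((1 : ℕ) : ℂ) * (Real.cos (2 * (1 : ℕ) * φ) : ℂ) * kernel x φ ^ (-b) +
      (Real.sin (2 * (1 : ℕ) * φ) : ℂ) *
        (-b * kernel x φ ^ (-b - 1) * (-x * (Real.sin (2 * φ) : ℂ)))) =
      2 * ((Real.cos (2 * (1 : ℕ) * φ) : ℂ) * kernel x φ ^ (-b)) +
      b * x * (((Real.sin (2 * φ) ^ 2 : ℝ) : ℂ) * kernel x φ ^ (-(b + 1))) := by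
    intro φ
    rw [show -b - 1 = -(b + 1) by ring]
    push_cast
    simp only [mul_one]
    ring
  simp_rw [e] at h
  rw [intervalIntegral.integral_add (Continuous.intervalIntegrable (by fun_prop) _ _)
    (Continuous.intervalIntegrable (by fun_prop) _ _), intervalIntegral.integral_const_mul,
    intervalIntegral.integral_const_mul] at h
  rw [fourierKernel]
  linear_combination h / 2

/-- Write `κ^(1-b) = κ κ^(-b)` for the kernel `κ`, which is affine in `cos 2φ`; the addition
formulas then produce the neighbouring frequencies. -/
lemma fourierKernel_recurrence {b x : ℂ} (hx : x ∈ cutPlane) (n : ℕ) :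
    ((n + 2 : ℂ) - b) * x * fourierKernel b x (n + 2) +
      2 * (n + 1) * (2 - x) * fourierKernel b x (n + 1) +
      (n + b) * x * fourierKernel b x n = 0 := by
  have h := integral_deriv_sin_mul_kernel hx (1 - b) (n + 1)
  have hk := continuous_kernel_cpow hx (-b)
  have e : ∀ φ : ℝ, (2 * ((n + 1 : ℕ) : ℂ) * (Real.cos (2 * (n + 1 : ℕ) * φ) : ℂ) *
      kernel x φ ^ (1 - b) + (Real.sin (2 * (n + 1 : ℕ) * φ) : ℂ) *
        ((1 - b) * kernel x φ ^ (1 - b - 1) * (-x * (Real.sin (2 * φ) : ℂ)))) =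
      ((n + 2 : ℂ) - b) * x / 2 * ((Real.cos (2 * (n + 2 : ℕ) * φ) : ℂ) * kernel x φ ^ (-b)) +
      (n + 1) * (2 - x) * ((Real.cos (2 * (n + 1 : ℕ) * φ) : ℂ) * kernel x φ ^ (-b)) +
      (n + b) * x / 2 * ((Real.cos (2 * n * φ) : ℂ) * kernel x φ ^ (-b)) := by
    intro φ
    have h1 : kernel x φ ^ (1 - b) = kernel x φ * kernel x φ ^ (-b) := by
      rw [sub_eq_add_neg, Complex.cpow_add _ _ (kernel_ne_zero hx φ), Complex.cpow_one]
    rw [h1, show 1 - b - 1 = -b by ring]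
    have h2 : Real.cos (2 * (n + 2 : ℕ) * φ) = Real.cos (2 * (n + 1 : ℕ) * φ) * Real.cos (2 * φ)
        - Real.sin (2 * (n + 1 : ℕ) * φ) * Real.sin (2 * φ) := by
      rw [← Real.cos_add]; congr 1; push_cast; ring
    have h3 : Real.cos (2 * n * φ) = Real.cos (2 * (n + 1 : ℕ) * φ) * Real.cos (2 * φ)
        + Real.sin (2 * (n + 1 : ℕ) * φ) * Real.sin (2 * φ) := by
      rw [← Real.cos_sub]; congr 1; push_cast; ring
    have h4 := kernel_eq x φ
    rw [h2, h3]
    set κ := kernel x φ ^ (-b)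
    rw [h4]
    push_cast
    ring
  simp_rw [e] at h
  rw [intervalIntegral.integral_add (Continuous.intervalIntegrable (by fun_prop) _ _)
    (Continuous.intervalIntegrable (by fun_prop) _ _),
    intervalIntegral.integral_add (Continuous.intervalIntegrable (by fun_prop) _ _)
    (Continuous.intervalIntegrable (by fun_prop) _ _), intervalIntegral.integral_const_mul,
    intervalIntegral.integral_const_mul, intervalIntegral.integral_const_mul] at h
  simp only [fourierKernel]
  linear_combination 2 * h

lemma norm_fourierKernel_le {b x : ℂ} (hx : x ∈ cutPlane) :
    ∃ M, ∀ n, ‖fourierKernel b x n‖ ≤ M := by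
  have hk := continuous_kernel_cpow hx (-b)
  refine ⟨∫ φ in (0 : ℝ)..Real.pi, ‖kernel x φ ^ (-b)‖, fun n => ?_⟩
  refine (intervalIntegral.norm_integral_le_integral_norm Real.pi_pos.le).trans
    (intervalIntegral.integral_mono_on Real.pi_pos.le ?_ ?_ fun φ _ => ?_)
  · exact Continuous.intervalIntegrable (by fun_prop) _ _
  · exact Continuous.intervalIntegrable (by fun_prop) _ _
  · rw [norm_mul, Complex.norm_real]
    exact mul_le_of_le_one_left (norm_nonneg _) (Real.abs_cos_le_one _)

lemma fourierKernel_zero_eq (b x : ℂ) :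
    fourierKernel b x 0 = ∫ φ in (0 : ℝ)..Real.pi, kernel x φ ^ (-b) := by
  simp [fourierKernel]

lemma fourierKernel_zero_ne_zero_of_lt_one (b : ℝ) {x : ℝ} (hx0 : 0 ≤ x) (hx : x < 1) :
    fourierKernel b x 0 ≠ 0 := by
  have hpos : ∀ φ, 0 < 1 - x * Real.sin φ ^ 2 := fun φ => by
    nlinarith [Real.sin_sq_le_one φ, sq_nonneg (Real.sin φ)]
  have e : ∀ φ : ℝ, kernel x φ ^ (-(b : ℂ)) = (((1 - x * Real.sin φ ^ 2) ^ (-b) : ℝ) : ℂ) := by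
    intro φ
    rw [Complex.ofReal_cpow (hpos φ).le, kernel]
    push_cast
    rfl
  rw [fourierKernel_zero_eq]
  simp_rw [e]
  rw [intervalIntegral.integral_ofReal, Complex.ofReal_ne_zero]
  refine ne_of_gt (intervalIntegral.intervalIntegral_pos_of_pos_on ?_ (fun φ _ => ?_) Real.pi_pos)
  · refine Continuous.intervalIntegrable ?_ _ _
    exact Continuous.rpow_const (by fun_prop) fun φ => Or.inl (hpos φ).ne'
  · exact Real.rpow_pos_of_pos (hpos φ) _

/-- For `0 < φ < π` the kernel lies in the lower half-plane, so its power `-b` has argument in `(0,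
bπ)` and positive imaginary part. -/
lemma fourierKernel_zero_ne_zero_of_im_pos {b : ℝ} (hb0 : 0 < b) (hb1 : b < 1) {x : ℂ}
    (hx : 0 < x.im) : fourierKernel b x 0 ≠ 0 := by
  have hcut : x ∈ cutPlane := Or.inr hx.ne'
  have hk := continuous_kernel_cpow hcut (-(b : ℂ))
  intro h
  rw [fourierKernel_zero_eq] at h
  have him : ∫ φ in (0 : ℝ)..Real.pi, (kernel x φ ^ (-(b : ℂ))).im = 0 := by
    have := Complex.imCLM.intervalIntegral_comp_comm (μ := volume) (a := 0) (b := Real.pi)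
      (hk.intervalIntegrable _ _)
    rw [h] at this
    simpa using this
  refine absurd him (ne_of_gt (intervalIntegral.intervalIntegral_pos_of_pos_on ?_ (fun φ hφ => ?_)
    Real.pi_pos))
  · exact Continuous.intervalIntegrable (by fun_prop) _ _
  · have hs : 0 < Real.sin φ := Real.sin_pos_of_mem_Ioo hφ
    have hki : (kernel x φ).im < 0 := by
      have hk' : kernel x φ = 1 - x * ((Real.sin φ ^ 2 : ℝ) : ℂ) := by simp [kernel]
      rw [hk']
      simp only [Complex.sub_im, Complex.one_im, Complex.im_mul_ofReal]
      have : 0 < x.im * Real.sin φ ^ 2 := by positivity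
      linarith
    have ha0 : (kernel x φ).arg < 0 := Complex.arg_neg_iff.2 hki
    have ha1 := Complex.neg_pi_lt_arg (kernel x φ)
    have hne : kernel x φ ≠ 0 := kernel_ne_zero hcut φ
    rw [← Complex.ofReal_neg, Complex.cpow_ofReal_im]
    refine mul_pos (Real.rpow_pos_of_pos (norm_pos_iff.2 hne) _) (Real.sin_pos_of_pos_of_lt_pi ?_ ?_)
    · nlinarith
    · nlinarith

/-- `T₀(1/2, b; z)` as an integral. -/
lemma T_zero_eq {b z : ℂ} (hz : 1 / z ∈ cutPlane) :
    T 0 (1 / 2) b z = Complex.Gamma (1 / 2) * Complex.Gamma b * (1 / z) ^ (1 / 2 : ℂ) *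
      (fourierKernel b (1 / z) 0 / Real.pi) := by
  have h := (isHypergeometricContinuation_half b).hyp2F1_eq hz
  simp only [one_mul] at h
  rw [T, fourierKernel_zero_eq]
  simp only [Nat.cast_zero, add_zero, mul_zero, mul_one_div, div_self (two_ne_zero' ℂ), h,
    Complex.Gamma_one, div_one]
  ring

/-- The prefactor agrees with that of `T₀` up to sign, so it cancels in the quotient. -/
lemma T_one_eq {b z : ℂ} (hb : b ≠ 0) (hz0 : z ≠ 0) (hz : 1 / z ∈ cutPlane) :
    T 1 (1 / 2) b z = -(Complex.Gamma (1 / 2) * Complex.Gamma b * (1 / z) ^ (1 / 2 : ℂ) *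
      (fourierKernel b (1 / z) 1 / Real.pi)) := by
  have h := (isHypergeometricContinuation_three_halves (b + 1)).hyp2F1_eq hz
  have hx0 : 1 / z ≠ 0 := one_div_ne_zero hz0
  have hpi : (Real.pi : ℂ) ≠ 0 := by exact_mod_cast Real.pi_ne_zero
  have hG3 : Complex.Gamma 3 = 2 := by
    rw [show (3 : ℂ) = ((2 : ℕ) : ℂ) + 1 by norm_num, Complex.Gamma_nat_eq_factorial]
    norm_num [Nat.factorial]
  have hG : Complex.Gamma (1 / 2 + 1) = 1 / 2 * Complex.Gamma (1 / 2) :=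
    Complex.Gamma_add_one _ (by norm_num)
  have e1 : (1 / 2 : ℂ) + 1 = 3 / 2 := by norm_num
  have e2 : 2 * (1 / 2 : ℂ) + 2 * 1 = 3 := by norm_num
  have hp : (1 / z) ^ (1 / 2 + 1 : ℂ) = (1 / z) ^ (1 / 2 : ℂ) * (1 / z) := by
    rw [Complex.cpow_add _ _ hx0, Complex.cpow_one]
  rw [T, fourierKernel_one hz]
  simp only [Nat.cast_one]
  rw [hG, hp, Complex.Gamma_add_one _ hb, e1, e2, h, hG3]
  field_simp

lemma T_zero_ne_zero {b : ℝ} (hb : 0 < b) {z : ℂ} (hz0 : z ≠ 0) (hz : 1 / z ∈ cutPlane)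
    (hV : fourierKernel b (1 / z) 0 ≠ 0) : T 0 (1 / 2) b z ≠ 0 := by
  have hpi : (Real.pi : ℂ) ≠ 0 := by exact_mod_cast Real.pi_ne_zero
  rw [T_zero_eq hz]
  refine mul_ne_zero (mul_ne_zero (mul_ne_zero ?_ ?_) ?_) (div_ne_zero hV hpi)
  · exact Complex.Gamma_ne_zero_of_re_pos (by norm_num)
  · exact Complex.Gamma_ne_zero_of_re_pos (by simpa using hb)
  · rw [Complex.cpow_ne_zero_iff_of_exponent_ne_zero (by norm_num)]
    exact one_div_ne_zero hz0

lemma T_one_div_T_zero {b : ℝ} (hb : 0 < b) {z : ℂ} (hz0 : z ≠ 0) (hz : 1 / z ∈ cutPlane)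
    (hV : fourierKernel b (1 / z) 0 ≠ 0) :
    T 1 (1 / 2) b z / T 0 (1 / 2) b z = -(fourierKernel b (1 / z) 1 / fourierKernel b (1 / z) 0) := by
  have hT := T_zero_ne_zero hb hz0 hz hV
  rw [div_eq_iff hT, T_zero_eq hz, T_one_eq (by exact_mod_cast hb.ne') hz0 hz]
  field_simp

end ContFracT

namespace ContFracT

open PerturbedRecurrence

/-! ### The recurrence of the convergents and its normalization -/

/-- `v` solves the recurrence of the numerators and denominators. -/
def IsConvergentSol {𝕜 : Type*} [Field 𝕜] (A K D : 𝕜) (v : ℕ → 𝕜) : Prop :=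
  ∀ n : ℕ, v (n + 2) = A * (n + 1) * v (n + 1) - K * (D * (n + 1) - 1) * (D * n + 1) * v n

/-- The solution `v` divided by `(n - 1)! R ^ n`, at `n = k + 1`. -/
def normalized {𝕜 : Type*} [Field 𝕜] (R : 𝕜) (v : ℕ → 𝕜) (k : ℕ) : 𝕜 :=
  v (k + 1) / (k.factorial * R ^ (k + 1))

/-- The perturbation in the recurrence of normalized solutions. -/
def perturbation {𝕜 : Type*} [Field 𝕜] (D : 𝕜) (k : ℕ) : 𝕜 :=
  (D - 1) / (D ^ 2 * ((k + 1) * (k + 2)))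

section Normalized

variable {𝕜 : Type*} [NormedField 𝕜] {A K D R : 𝕜} {v w : ℕ → 𝕜}

/-- The perturbation comes from `(D(k+2) - 1)(D(k+1) + 1) = D²(k+1)(k+2) + (D - 1)`, and the
characteristic equation gives `1 + r = A/R`. -/
lemma IsConvergentSol.isSol [CharZero 𝕜] (hv : IsConvergentSol A K D v) (hD : D ≠ 0) (hR : R ≠ 0)
    (hchar : R ^ 2 = A * R - K * D ^ 2) :
    IsSol (K * D ^ 2 / R ^ 2) (perturbation D) (normalized R v) := by
  intro k
  have h1 : (k : 𝕜) + 1 ≠ 0 := by exact_mod_cast k.succ_ne_zero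
  have h2 : (k : 𝕜) + 2 ≠ 0 := by exact_mod_cast (k + 1).succ_ne_zero
  have h3 : (k.factorial : 𝕜) ≠ 0 := by exact_mod_cast k.factorial_ne_zero
  have h2' : (k : 𝕜) + 1 + 1 ≠ 0 := by rwa [add_assoc, one_add_one_eq_two]
  have hr : 1 + K * D ^ 2 / R ^ 2 = A / R := by
    field_simp
    linear_combination hchar
  rw [hr]
  simp only [normalized, perturbation, Nat.factorial_succ]
  rw [show k + 2 + 1 = (k + 1) + 2 by ring, hv (k + 1)]
  push_cast
  field_simp
  ring

/-- Normalized indices `0, 1` are original indices `1, 2`; one step of the recurrence brings the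
Casoratian back to the initial data at `0, 1`. -/
lemma IsConvergentSol.casoratian_normalized (hv : IsConvergentSol A K D v)
    (hw : IsConvergentSol A K D w) (hR : R ≠ 0) :
    normalized R v 1 * normalized R w 0 - normalized R v 0 * normalized R w 1 =
      K * (D - 1) / R ^ 3 * (v 1 * w 0 - v 0 * w 1) := by
  have h1 := hv 0
  have h2 := hw 0
  simp only [normalized, zero_add, Nat.factorial, one_add_one_eq_two] at h1 h2 ⊢
  rw [h1, h2]
  push_cast
  field_simp
  ring

end Normalized

lemma summable_perturbation (D : ℝ) : Summable (perturbation D) := by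
  have h : Summable fun k : ℕ => (((k : ℝ) + 1) ^ 2)⁻¹ := by
    have := (summable_nat_add_iff 1).2 (Real.summable_one_div_nat_pow.2 one_lt_two)
    exact this.congr fun k => by push_cast; rw [one_div]
  refine Summable.of_norm_bounded (h.mul_left (|D - 1| / D ^ 2)) fun k => ?_
  rw [perturbation, Real.norm_eq_abs, abs_div, abs_of_nonneg (by positivity : 0 ≤ D ^ 2 * _),
    ← div_div, div_eq_mul_inv (|D - 1| / D ^ 2)]
  refine mul_le_mul_of_nonneg_left (inv_anti₀ (by positivity) ?_) (by positivity)
  nlinarith [(k.cast_nonneg : (0 : ℝ) ≤ k)]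

lemma perturbation_nonneg {D : ℝ} (hD : 1 ≤ D) (k : ℕ) : 0 ≤ perturbation D k :=
  div_nonneg (by linarith) (by positivity)

lemma ofReal_perturbation (D : ℝ) (k : ℕ) :
    perturbation (D : ℂ) k = ((perturbation D k : ℝ) : ℂ) := by
  simp [perturbation]

section Convergents

variable (A K D a₁ b₀ : ℝ)

lemma cfC_get (n : ℕ) : (cfC A K D a₁ b₀).s.get? n =
    some ⟨if n = 0 then b₀ else -K * (D * (n : ℝ) - 1) * (D * ((n : ℝ) - 1) + 1),
      if n + 1 = 1 then a₁ else A * (((n + 1 : ℕ) : ℝ) - 1)⟩ := rfl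

lemma p_zero : p A K D a₁ b₀ 0 = 0 := by
  simp [p, GenContFract.zeroth_num_eq_h, cfC, cf]

lemma q_zero : q A K D a₁ b₀ 0 = 1 := by
  simp [q, GenContFract.zeroth_den_eq_one]

lemma p_one : p A K D a₁ b₀ 1 = b₀ := by
  rw [p, GenContFract.first_num_eq (cfC_get A K D a₁ b₀ 0)]
  simp [cfC, cf]

lemma q_one : q A K D a₁ b₀ 1 = a₁ := by
  rw [q, GenContFract.first_den_eq (cfC_get A K D a₁ b₀ 0)]
  simp

lemma isConvergentSol_p : IsConvergentSol A K D (p A K D a₁ b₀) := by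
  intro n
  simp only [p]
  rw [GenContFract.nums_recurrence (cfC_get A K D a₁ b₀ (n + 1)) rfl rfl]
  simp
  ring

lemma isConvergentSol_q : IsConvergentSol A K D (q A K D a₁ b₀) := by
  intro n
  simp only [q]
  rw [GenContFract.dens_recurrence (cfC_get A K D a₁ b₀ (n + 1)) rfl rfl]
  simp
  ring

end Convergents

/-! ### The characteristic roots -/

lemma R_pos {A K D : ℝ} (hA : 0 < A) : 0 < R A K D := by
  have := Real.sqrt_nonneg (A ^ 2 - 4 * K * D ^ 2)
  rw [R]; positivity

lemma R_sq {A K D : ℝ} (hdisc : 0 < A ^ 2 - 4 * K * D ^ 2) :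
    R A K D ^ 2 = A * R A K D - K * D ^ 2 := by
  have := Real.sq_sqrt hdisc.le
  rw [R]
  linear_combination this / 4

/-- The characteristic roots have product `KD²`, and `R` is the one of strictly larger modulus. -/
lemma abs_mul_sq_lt_R_sq {A K D : ℝ} (hA : 0 < A) (hdisc : 0 < A ^ 2 - 4 * K * D ^ 2) :
    |K| * D ^ 2 < R A K D ^ 2 := by
  have h0 := R_pos (K := K) (D := D) hA
  have h1 : A / 2 < R A K D := by
    have := Real.sqrt_pos.2 hdisc
    rw [R]; linarith
  rcases abs_cases K with ⟨h, -⟩ | ⟨h, -⟩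
  · rw [h]; nlinarith
  · rw [h, R_sq hdisc]; nlinarith

lemma one_div_E (A K D : ℝ) : K * D ^ 2 / R A K D ^ 2 = (E A K D)⁻¹ := by
  rw [E, inv_div]

/-! ### The minimal solution -/

lemma sqrtC_sq (K : ℝ) : sqrtC K ^ 2 = K := by
  rw [sqrtC, one_div]
  exact Complex.cpow_ofNat_inv_pow _ 2

lemma norm_sqrtC_sq (K : ℝ) : ‖sqrtC K‖ ^ 2 = |K| := by
  rw [← norm_pow, sqrtC_sq, Complex.norm_real, Real.norm_eq_abs]

lemma sqrtC_ne_zero {K : ℝ} (hK : K ≠ 0) : sqrtC K ≠ 0 := fun h => by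
  have := sqrtC_sq K
  rw [h] at this
  exact hK (by simpa using this.symm)

lemma sqrtC_of_pos {K : ℝ} (hK : 0 < K) : sqrtC K = (Real.sqrt K : ℝ) := by
  rw [sqrtC, Real.sqrt_eq_rpow, Complex.ofReal_cpow hK.le]
  norm_num

lemma sqrtC_of_neg {K : ℝ} (hK : K < 0) : sqrtC K = (Real.sqrt (-K) : ℝ) * Complex.I := by
  rw [sqrtC, Complex.ofReal_cpow_of_nonpos hK.le, Real.sqrt_eq_rpow,
    Complex.ofReal_cpow (by linarith)]
  congr 1
  · norm_num
  · rw [show (Real.pi : ℂ) * Complex.I * (1 / 2) = Real.pi / 2 * Complex.I by ring,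
      Complex.exp_pi_div_two_mul_I]

/-- The point at which the hypergeometric functions are evaluated. -/
noncomputable def basePoint (A K D : ℝ) : ℂ := 1 / 2 + (A : ℂ) / (4 * (D : ℂ) * sqrtC K)

/-- The discriminant condition reads `A > 2D√K`, which puts the base point to the right of `1`. -/
lemma one_div_basePoint_of_pos {A K D : ℝ} (hA : 0 < A) (hK : 0 < K) (hD : 2 ≤ D)
    (hdisc : 0 < A ^ 2 - 4 * K * D ^ 2) :
    ∃ x : ℝ, 0 < x ∧ x < 1 ∧ 1 / basePoint A K D = x := by
  have hs := Real.sqrt_pos.2 hK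
  have hs2 := Real.sq_sqrt hK.le
  set s := Real.sqrt K with hsdef
  have h1 : 2 * D * s < A := by
    refine lt_of_pow_lt_pow_left₀ 2 hA.le ?_
    rw [mul_pow, hs2]; linarith
  have h2 : 1 < 1 / 2 + A / (4 * D * s) := by
    have : 1 / 2 < A / (4 * D * s) := by
      rw [lt_div_iff₀ (by positivity)]; linarith
    linarith
  refine ⟨1 / (1 / 2 + A / (4 * D * s)), by positivity, ?_, ?_⟩
  · rw [div_lt_one (by linarith)]; exact h2
  · rw [basePoint, sqrtC_of_pos hK]; push_cast; rfl

/-- With `K^(1/2)` positive imaginary, the base point lies in the lower half-plane and its inverse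
in the upper one. -/
lemma one_div_basePoint_im_pos {A K D : ℝ} (hA : 0 < A) (hK : K < 0) (hD : 2 ≤ D) :
    0 < (1 / basePoint A K D).im := by
  have hs : 0 < Real.sqrt (-K) := Real.sqrt_pos.2 (by linarith)
  set s := Real.sqrt (-K) with hsdef
  have hsC : (s : ℂ) ≠ 0 := by exact_mod_cast hs.ne'
  have hDC : (D : ℂ) ≠ 0 := by exact_mod_cast (by linarith : D ≠ 0)
  have hb : basePoint A K D = ((1 / 2 : ℝ) : ℂ) + ((-(A / (4 * D * s)) : ℝ) : ℂ) * Complex.I := by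
    rw [basePoint, sqrtC_of_neg hK]
    push_cast
    have : (A : ℂ) / (4 * D * (s * Complex.I)) = -(A / (4 * D * s)) * Complex.I := by
      rw [div_eq_iff (by simp [hsC, hDC]), neg_mul, neg_mul, div_mul_eq_mul_div, div_mul_eq_mul_div,
        eq_neg_iff_add_eq_zero, ← eq_neg_iff_add_eq_zero, eq_neg_iff_add_eq_zero]
      field_simp
      rw [Complex.I_sq]; ring
    rw [this]
  have him : (basePoint A K D).im = -(A / (4 * D * s)) := by rw [hb]; simp [-Complex.ofReal_neg, -Complex.ofReal_div, -Complex.ofReal_mul]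
  have hpos : 0 < A / (4 * D * s) := by positivity
  have hne : basePoint A K D ≠ 0 := fun h => by
    rw [h, Complex.zero_im] at him
    linarith
  rw [one_div, Complex.inv_im, him, neg_neg]
  exact div_pos hpos (Complex.normSq_pos.2 hne)

section Minimal

variable {A K D : ℝ}

lemma basePoint_facts (hA : 0 < A) (hK : K ≠ 0) (hD : 2 ≤ D)
    (hdisc : 0 < A ^ 2 - 4 * K * D ^ 2) :
    basePoint A K D ≠ 0 ∧ 1 / basePoint A K D ∈ cutPlane ∧
      fourierKernel ((1 - 1 / D : ℝ) : ℂ) (1 / basePoint A K D) 0 ≠ 0 := by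
  have hDinv : 0 < 1 / D := by positivity
  have hDinv1 : 1 / D < 1 := by rw [div_lt_one] <;> linarith
  rcases hK.lt_or_gt with hK | hK
  · have h := one_div_basePoint_im_pos hA hK hD
    refine ⟨fun h0 => ?_, Or.inr h.ne', fourierKernel_zero_ne_zero_of_im_pos (by linarith)
      (by linarith) h⟩
    rw [h0] at h; simp at h
  · obtain ⟨x, hx0, hx1, hx⟩ := one_div_basePoint_of_pos hA hK hD hdisc
    refine ⟨fun h0 => ?_, ?_, ?_⟩
    · rw [h0] at hx
      simp only [div_zero] at hx
      exact hx0.ne (by exact_mod_cast hx)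
    · rw [hx]; left; simpa using hx1
    · rw [hx]; exact fourierKernel_zero_ne_zero_of_lt_one _ hx0.le hx1

/-- A solution of the recurrence of the convergents that grows more slowly than the others. -/
noncomputable def minimalSol (A K D : ℝ) (n : ℕ) : ℂ :=
  (-sqrtC K) ^ n * (∏ j ∈ Finset.range n, ((D : ℂ) * j + 1)) *
    fourierKernel ((1 - 1 / D : ℝ) : ℂ) (1 / basePoint A K D) n

lemma isConvergentSol_minimalSol (hA : 0 < A) (hK : K ≠ 0) (hD : 2 ≤ D)
    (hdisc : 0 < A ^ 2 - 4 * K * D ^ 2) :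
    IsConvergentSol (A : ℂ) K D (minimalSol A K D) := by
  intro n
  obtain ⟨hz, hcut, -⟩ := basePoint_facts hA hK hD hdisc
  have hrec := fourierKernel_recurrence (b := ((1 - 1 / D : ℝ) : ℂ)) hcut n
  have hκ := sqrtC_ne_zero hK
  have hκ2 := sqrtC_sq K
  have hDC : (D : ℂ) ≠ 0 := by exact_mod_cast (by linarith : D ≠ 0)
  simp only [minimalSol, Finset.prod_range_succ, pow_succ]
  set V := fourierKernel ((1 - 1 / D : ℝ) : ℂ) (1 / basePoint A K D)
  set P := ∏ j ∈ Finset.range n, ((D : ℂ) * j + 1)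
  have hzκ : 2 * basePoint A K D * sqrtC K * D = D * sqrtC K + A / 2 := by
    rw [basePoint]; field_simp; ring
  -- Multiplying the Fourier recurrence by the base point `z` brings in `2z - 1 = A / (2D K^(1/2))`;
  -- the choice `b = 1 - 1/D` makes `D(n+2-b)` and `D(n+b)` equal to `D(n+1) ± 1`.
  have hrec' : (D * (n + 1) + 1) * sqrtC K * V (n + 2) + (n + 1) * A * V (n + 1) +
      (D * (n + 1) - 1) * sqrtC K * V n = 0 := by
    have h2 : ((n + 2 : ℂ) - ((1 - 1 / D : ℝ) : ℂ)) * D = D * (n + 1) + 1 := by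
      push_cast; field_simp; ring
    have h3 : ((n : ℂ) + ((1 - 1 / D : ℝ) : ℂ)) * D = D * (n + 1) - 1 := by
      push_cast; field_simp; ring
    have h4 : ((n + 2 : ℂ) - ((1 - 1 / D : ℝ) : ℂ)) * V (n + 2) +
        2 * (n + 1) * (2 * basePoint A K D - 1) * V (n + 1) +
        (n + ((1 - 1 / D : ℝ) : ℂ)) * V n = 0 := by
      have := congrArg (· * basePoint A K D) hrec
      simp only [zero_mul] at this
      rw [← this]
      field_simp
    rw [← h2, ← h3]
    linear_combination (D * sqrtC K) * h4 - 2 * (n + 1) * V (n + 1) * hzκ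
  push_cast
  rw [← hκ2]
  linear_combination (-sqrtC K) ^ n * P * (D * n + 1) * sqrtC K * hrec'

/-- The Fourier coefficients are bounded, and the remaining factor has ratio of consecutive terms
tending to `|K|^(1/2) D / R < 1`. -/
lemma tendsto_minimalSol (hA : 0 < A) (hK : K ≠ 0) (hD : 2 ≤ D)
    (hdisc : 0 < A ^ 2 - 4 * K * D ^ 2) :
    Tendsto (normalized (R A K D : ℂ) (minimalSol A K D)) atTop (𝓝 0) := by
  obtain ⟨hz, hcut, -⟩ := basePoint_facts hA hK hD hdisc
  obtain ⟨M, hM⟩ := norm_fourierKernel_le (b := ((1 - 1 / D : ℝ) : ℂ)) hcut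
  have hR := R_pos (K := K) (D := D) hA
  set ρ := ‖sqrtC K‖ with hρ
  have hρ0 : 0 < ρ := norm_pos_iff.2 (sqrtC_ne_zero hK)
  have hlt : ρ * D / R A K D < 1 := by
    rw [div_lt_one hR]
    refine lt_of_pow_lt_pow_left₀ 2 hR.le ?_
    rw [mul_pow, norm_sqrtC_sq]
    exact abs_mul_sq_lt_R_sq hA hdisc
  set g : ℕ → ℝ := fun k => ρ ^ (k + 1) * (∏ j ∈ Finset.range (k + 1), (D * j + 1)) /
    (k.factorial * R A K D ^ (k + 1)) with hg
  have hprod : ∀ k, 0 < ∏ j ∈ Finset.range k, (D * (j : ℝ) + 1) := fun k =>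
    Finset.prod_pos fun j _ => by positivity
  have hgpos : ∀ k, 0 < g k := fun k => by
    have := hprod (k + 1)
    simp only [hg]; positivity
  have hratio : ∀ k : ℕ, ‖g (k + 1)‖ / ‖g k‖ = ρ / R A K D * (D + 1 / ((k : ℝ) + 1)) := by
    intro k
    rw [Real.norm_of_nonneg (hgpos _).le, Real.norm_of_nonneg (hgpos _).le]
    simp only [hg]
    rw [Finset.prod_range_succ _ (k + 1), Nat.factorial_succ]
    have := (hprod (k + 1)).ne'
    have h3 : (k.factorial : ℝ) ≠ 0 := by exact_mod_cast k.factorial_ne_zero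
    push_cast
    field_simp
    ring
  have hlim : Tendsto (fun k => ‖g (k + 1)‖ / ‖g k‖) atTop (𝓝 (ρ * D / R A K D)) := by
    simp_rw [hratio]
    have := (tendsto_one_div_add_atTop_nhds_zero_nat (𝕜 := ℝ)).const_add D |>.const_mul
      (ρ / R A K D)
    rwa [add_zero, div_mul_eq_mul_div] at this
  have hg0 : Tendsto g atTop (𝓝 0) := (summable_of_ratio_test_tendsto_lt_one hlt
    (Eventually.of_forall fun k => (hgpos k).ne') hlim).tendsto_atTop_zero
  refine squeeze_zero_norm (fun k => ?_) (by simpa using hg0.const_mul M)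
  have hnp : ‖∏ j ∈ Finset.range (k + 1), ((D : ℂ) * j + 1)‖ =
      ∏ j ∈ Finset.range (k + 1), (D * (j : ℝ) + 1) := by
    rw [← Real.norm_of_nonneg (hprod (k + 1)).le, ← Complex.norm_real]
    push_cast; rfl
  rw [normalized, minimalSol, norm_div, norm_mul, norm_mul, norm_mul, norm_pow, norm_pow, norm_neg,
    hnp, Complex.norm_real, Real.norm_of_nonneg hR.le, Complex.norm_natCast]
  have := hprod (k + 1)
  calc _ ≤ ρ ^ (k + 1) * (∏ j ∈ Finset.range (k + 1), (D * (j : ℝ) + 1)) * M /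
        (k.factorial * R A K D ^ (k + 1)) := by
        gcongr
        exact hM _
    _ = _ := by simp only [hg]; ring

lemma minimalSol_zero_ne_zero (hA : 0 < A) (hK : K ≠ 0) (hD : 2 ≤ D)
    (hdisc : 0 < A ^ 2 - 4 * K * D ^ 2) : minimalSol A K D 0 ≠ 0 := by
  simpa [minimalSol] using (basePoint_facts hA hK hD hdisc).2.2

lemma T_zero_basePoint_ne_zero (hA : 0 < A) (hK : K ≠ 0) (hD : 2 ≤ D)
    (hdisc : 0 < A ^ 2 - 4 * K * D ^ 2) :
    T 0 (1 / 2) (1 - 1 / (D : ℂ)) (1 / 2 + (A : ℂ) / (4 * (D : ℂ) * sqrtC K)) ≠ 0 := by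
  obtain ⟨hz, hcut, hV⟩ := basePoint_facts hA hK hD hdisc
  have hb : 0 < 1 - 1 / D := by
    have : 1 / D < 1 := by rw [div_lt_one] <;> linarith
    linarith
  have := T_zero_ne_zero hb hz hcut hV
  push_cast at this
  exact this

lemma sqrtC_mul_Q (hA : 0 < A) (hK : K ≠ 0) (hD : 2 ≤ D)
    (hdisc : 0 < A ^ 2 - 4 * K * D ^ 2) :
    sqrtC K * Q A K D = minimalSol A K D 1 / minimalSol A K D 0 := by
  obtain ⟨hz, hcut, hV⟩ := basePoint_facts hA hK hD hdisc
  have hb : 0 < 1 - 1 / D := by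
    have : 1 / D < 1 := by rw [div_lt_one] <;> linarith
    linarith
  have h := T_one_div_T_zero hb hz hcut hV
  have hQ : Q A K D = T 1 (1 / 2) ((1 - 1 / D : ℝ) : ℂ) (basePoint A K D) /
      T 0 (1 / 2) ((1 - 1 / D : ℝ) : ℂ) (basePoint A K D) := by
    rw [Q]; push_cast; rfl
  rw [hQ, h]
  simp only [minimalSol, Finset.prod_range_succ, Finset.prod_range_zero]
  simp
  ring

end Minimal

end ContFracT

namespace ContFracT

open PerturbedRecurrence

/-! ### Logarithmic growth -/

/-- Cesàro averaging of the telescoping logarithms of the ratios. -/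
lemma tendsto_log_div_of_ratio {u : ℕ → ℝ} {l : ℝ} (hu : ∀ n, 0 < u n) (hl : 0 < l)
    (h : Tendsto (fun n => u (n + 1) / u n) atTop (𝓝 l)) :
    Tendsto (fun n : ℕ => Real.log (u n) / n) atTop (𝓝 (Real.log l)) := by
  have h1 := (h.log hl.ne').cesaro
  have h2 : ∀ n, ∑ i ∈ Finset.range n, Real.log (u (i + 1) / u i) =
      Real.log (u n) - Real.log (u 0) := by
    intro n
    rw [← Finset.sum_range_sub (fun i => Real.log (u i))]
    exact Finset.sum_congr rfl fun i _ => Real.log_div (hu _).ne' (hu _).ne'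
  have h3 := h1.add (tendsto_const_div_atTop_nhds_zero_nat (Real.log (u 0)))
  rw [add_zero] at h3
  refine h3.congr fun n => ?_
  rw [h2]; ring

lemma tendsto_log_abs_div_zero {u : ℕ → ℝ} {c : ℝ} (hc : c ≠ 0) (h : Tendsto u atTop (𝓝 c)) :
    Tendsto (fun n : ℕ => Real.log |u n| / n) atTop (𝓝 0) :=
  (h.abs.log (abs_ne_zero.2 hc)).div_atTop tendsto_natCast_atTop_atTop

lemma tendsto_natCast_succ_div_two_div :
    Tendsto (fun k : ℕ => (((k + 1) / 2 : ℕ) : ℝ) / k) atTop (𝓝 (1 / 2)) := by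
  have h : Tendsto (fun k : ℕ => 1 / 2 + 1 / 2 / (k : ℝ)) atTop (𝓝 (1 / 2)) := by
    have := (tendsto_const_div_atTop_nhds_zero_nat (1 / 2 : ℝ)).const_add (1 / 2)
    rwa [add_zero] at this
  refine tendsto_of_tendsto_of_tendsto_of_le_of_le' tendsto_const_nhds h ?_ ?_
  · filter_upwards [eventually_gt_atTop 0] with k hk
    have hk' : (0 : ℝ) < k := by exact_mod_cast hk
    have : k ≤ 2 * ((k + 1) / 2) := by omega
    have : (k : ℝ) ≤ 2 * (((k + 1) / 2 : ℕ) : ℝ) := by exact_mod_cast this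
    rw [le_div_iff₀ hk']; linarith
  · filter_upwards [eventually_gt_atTop 0] with k hk
    have hk' : (0 : ℝ) < k := by exact_mod_cast hk
    have : 2 * ((k + 1) / 2) ≤ k + 1 := by omega
    have : 2 * (((k + 1) / 2 : ℕ) : ℝ) ≤ k + 1 := by exact_mod_cast this
    rw [div_le_iff₀ hk', add_mul, div_mul_cancel₀ _ hk'.ne']; linarith

lemma isEquivalent_of_tendsto_succ_div {u v : ℕ → ℝ}
    (h : Tendsto (fun k => u (k + 1) / v (k + 1)) atTop (𝓝 1)) : u ~[atTop] v :=
  isEquivalent_of_tendsto_one ((tendsto_add_atTop_iff_nat (f := u / v) 1).1 h)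

lemma f_eq (K D : ℝ) (n : ℕ) :
    f K D n = |K| ^ (n / 2) * ∏ j ∈ Finset.range n, (D * (j : ℝ) + 1) := by
  rw [f]
  congr 1
  induction n with
  | zero => simp
  | succ n ih =>
    rw [Finset.prod_Icc_succ_top (by omega), ih, Finset.prod_range_succ]
    push_cast
    ring

/-- Size of the normalized error in terms of the normalized denominator and the error. -/
lemma tendsto_log_error {K D R r x c : ℝ} (hK : K ≠ 0) (hD : 0 < D) (hR : 0 < R) (hr : r ≠ 0)
    {X Y : ℕ → ℝ} (hx : x ≠ 0) (hc : c ≠ 0) (hX : Tendsto X atTop (𝓝 x))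
    (hY : Tendsto Y atTop (𝓝 c)) :
    Tendsto (fun k : ℕ => Real.log |X k * (k.factorial * R ^ (k + 1)) * (Y k * r ^ k) /
        f K D (k + 1)| / k) atTop (𝓝 (Real.log (R * |r| / D) - Real.log |K| / 2)) := by
  have hprod : ∀ k, 0 < ∏ j ∈ Finset.range k, (D * (j : ℝ) + 1) := fun k =>
    Finset.prod_pos fun j _ => by positivity
  have hr' : 0 < |r| := abs_pos.2 hr
  have hK' : 0 < |K| := abs_pos.2 hK
  -- Everything with a convergent ratio goes into `u`; the power of `|K|`, whose exponent is a
  -- floor, is treated separately.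
  set u : ℕ → ℝ := fun k => k.factorial * R ^ (k + 1) * |r| ^ k /
    ∏ j ∈ Finset.range (k + 1), (D * (j : ℝ) + 1) with hu
  have hupos : ∀ k, 0 < u k := fun k => by
    have := hprod (k + 1)
    simp only [hu]; positivity
  have hratio : Tendsto (fun k => u (k + 1) / u k) atTop (𝓝 (R * |r| / D)) := by
    have h1 : Tendsto (fun k : ℕ => R * |r| / (D + 1 / ((k : ℝ) + 1))) atTop
        (𝓝 (R * |r| / (D + 0))) :=
      tendsto_const_nhds.div (tendsto_one_div_add_atTop_nhds_zero_nat.const_add D) (by simpa using hD.ne')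
    rw [add_zero] at h1
    refine h1.congr fun k => ?_
    simp only [hu]
    rw [Finset.prod_range_succ _ (k + 1), Nat.factorial_succ]
    have := (hprod (k + 1)).ne'
    have h3 : (k.factorial : ℝ) ≠ 0 := by exact_mod_cast k.factorial_ne_zero
    have h4 : D * ((k : ℝ) + 1) + 1 ≠ 0 := by positivity
    push_cast
    field_simp
    ring
  have hlim := (((tendsto_log_abs_div_zero hx hX).add (tendsto_log_abs_div_zero hc hY)).add
    (tendsto_log_div_of_ratio hupos (by positivity) hratio)).sub
    (tendsto_natCast_succ_div_two_div.mul_const (Real.log |K|))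
  rw [zero_add, zero_add, one_div_mul_eq_div] at hlim
  refine hlim.congr' ?_
  filter_upwards [hX.eventually_ne hx, hY.eventually_ne hc] with k h1 h2
  have h3 : |X k * (k.factorial * R ^ (k + 1)) * (Y k * r ^ k) / f K D (k + 1)| =
      |X k| * |Y k| * u k / |K| ^ ((k + 1) / 2) := by
    rw [f_eq, abs_div, abs_mul, abs_mul, abs_mul (Y k), abs_mul (|K| ^ _), abs_pow r, abs_pow |K|,
      abs_abs, abs_of_pos (hprod (k + 1)), abs_of_pos (by positivity : 0 < (k.factorial : ℝ) * _)]
    simp only [hu]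
    have := (hprod (k + 1)).ne'
    field_simp
  have hU := (hupos k).ne'
  rw [h3]
  generalize u k = U at hU
  rw [Real.log_div (by positivity) (by positivity), Real.log_mul (by positivity) hU, Real.log_mul (by positivity) (by positivity),
    Real.log_pow]
  ring

/-- This is `R|r| / (D |K|^(1/2)) = |E|^(-1/2)` for `r = 1/E`. -/
lemma log_rate {A K D : ℝ} (hK : K ≠ 0) (hD : 2 ≤ D) (hR : 0 < R A K D) :
    Real.log (R A K D * |(E A K D)⁻¹| / D) - Real.log |K| / 2 = -(Real.log |E A K D| / 2) := by
  have hK' : 0 < |K| := abs_pos.2 hK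
  have hD0 : 0 < D := by linarith
  have hE : |E A K D| = R A K D ^ 2 / (|K| * D ^ 2) := by
    rw [E, abs_div, abs_mul, abs_pow, abs_pow, abs_of_pos hR, abs_of_pos hD0]
  have hE0 : 0 < |E A K D| := by rw [hE]; positivity
  have h2 : Real.log |E A K D| = 2 * Real.log (R A K D) - (Real.log |K| + 2 * Real.log D) := by
    rw [hE, Real.log_div (by positivity) (by positivity), Real.log_mul hK'.ne' (by positivity),
      Real.log_pow, Real.log_pow]
    push_cast; rfl
  rw [abs_inv, Real.log_div (by positivity) hD0.ne', Real.log_mul hR.ne' (by positivity),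
    Real.log_inv]
  linarith

lemma one_lt_abs_E {A K D : ℝ} (hA : 0 < A) (hK : K ≠ 0) (hD : 2 ≤ D)
    (hdisc : 0 < A ^ 2 - 4 * K * D ^ 2) : 1 < |E A K D| := by
  have hK' : 0 < |K| := abs_pos.2 hK
  have hD0 : 0 < D := by linarith
  rw [E, abs_div, abs_mul, abs_pow, abs_pow, abs_of_pos (R_pos hA), abs_of_pos hD0,
    one_lt_div (by positivity)]
  exact abs_mul_sq_lt_R_sq hA hdisc

/-- A real solution whose normalization tends to zero is proportional to the minimal solution. -/
lemma IsConvergentSol.proportional_minimalSol {A K D : ℝ} {v : ℕ → ℝ}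
    (hv : IsConvergentSol A K D v) (hA : 0 < A) (hK : K ≠ 0) (hD : 2 ≤ D)
    (hdisc : 0 < A ^ 2 - 4 * K * D ^ 2)
    (h0 : Tendsto (normalized (R A K D) v) atTop (𝓝 0)) :
    (v 1 : ℂ) * minimalSol A K D 0 = v 0 * minimalSol A K D 1 := by
  have hR := R_pos (K := K) (D := D) hA
  have hRC : (R A K D : ℂ) ≠ 0 := by exact_mod_cast hR.ne'
  have hD0 : D ≠ 0 := by linarith
  have hDC : (D : ℂ) ≠ 0 := by exact_mod_cast hD0
  have hKC : (K : ℂ) ≠ 0 := by exact_mod_cast hK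
  have hchar : (R A K D : ℂ) ^ 2 = A * R A K D - K * D ^ 2 := by exact_mod_cast R_sq hdisc
  have hvC : IsConvergentSol (A : ℂ) K D fun n => (v n : ℂ) := fun n => by
    have := congrArg (fun t : ℝ => (t : ℂ)) (hv n)
    push_cast at this
    exact this
  have hm := isConvergentSol_minimalSol hA hK hD hdisc
  have hcast : normalized (R A K D : ℂ) (fun n => (v n : ℂ)) =
      fun k => ((normalized (R A K D) v k : ℝ) : ℂ) := by
    funext k; simp [normalized]
  have h0C : Tendsto (normalized (R A K D : ℂ) fun n => (v n : ℂ)) atTop (𝓝 0) := by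
    rw [hcast]
    have := (Complex.continuous_ofReal.tendsto 0).comp h0
    rwa [Complex.ofReal_zero] at this
  have hr : ‖(K : ℂ) * D ^ 2 / (R A K D : ℂ) ^ 2‖ < 1 := by
    have h1 := abs_mul_sq_lt_R_sq hA hdisc
    rw [norm_div, norm_mul, norm_pow, norm_pow, Complex.norm_real, Complex.norm_real,
      Complex.norm_real, Real.norm_eq_abs, Real.norm_eq_abs, Real.norm_eq_abs, sq_abs, sq_abs,
      div_lt_one (by positivity)]
    exact h1
  have hpert := perturbation_nonneg (D := D) (by linarith)
  have := (hvC.isSol hDC hRC hchar).proportional_of_tendsto_zero (hm.isSol hDC hRC hchar) hr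
    (div_ne_zero (mul_ne_zero hKC (pow_ne_zero _ hDC)) (pow_ne_zero _ hRC))
    (by
      refine (summable_perturbation D).congr fun k => ?_
      rw [ofReal_perturbation, Complex.norm_real, Real.norm_of_nonneg (hpert k)])
    (fun k => by
      rw [ofReal_perturbation, ← Complex.ofReal_one, ← Complex.ofReal_add, Complex.norm_real]
      exact (by linarith [hpert k] : 1 ≤ 1 + perturbation D k).trans (Real.le_norm_self _))
    h0C (tendsto_minimalSol hA hK hD hdisc)
  -- Proportionality is known at normalized indices `0, 1`; the factor `K(D-1)/R³` is nonzero, so it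
  -- transfers to the initial values.
  have hcas := hvC.casoratian_normalized hm hRC
  rw [this, sub_self] at hcas
  have hfac : (K : ℂ) * (D - 1) / (R A K D : ℂ) ^ 3 ≠ 0 := by
    refine div_ne_zero (mul_ne_zero hKC ?_) (pow_ne_zero _ hRC)
    rw [sub_ne_zero]
    exact_mod_cast (by linarith : D ≠ 1)
  exact sub_eq_zero.1 ((mul_eq_zero.1 hcas.symm).resolve_left hfac)

end ContFracT

/-! ### Assembly: limit, rates and value -/

theorem mainTheorem3 (A K D a₁ b₀ : ℝ) (hA : 0 < A) (hK : K ≠ 0) (hD : 2 ≤ D)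
    (hdisc : 0 < A ^ 2 - 4 * K * D ^ 2) (hb₀ : b₀ ≠ 0)
    (hden : (a₁ : ℂ) - ContFracT.sqrtC K * ContFracT.Q A K D ≠ 0) :
    ∃ L : ℝ,
      Tendsto (fun n : ℕ => ContFracT.p A K D a₁ b₀ n / ContFracT.q A K D a₁ b₀ n) atTop (𝓝 L) ∧
      1 < |ContFracT.E A K D| ∧
      (∃ C₁ : ℝ, C₁ ≠ 0 ∧
        (fun n : ℕ => L - ContFracT.p A K D a₁ b₀ n / ContFracT.q A K D a₁ b₀ n)
          ~[atTop] fun n : ℕ => C₁ / ContFracT.E A K D ^ n) ∧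
      (∃ C₂ : ℝ, C₂ ≠ 0 ∧
        (fun n : ℕ => ContFracT.q A K D a₁ b₀ n)
          ~[atTop] fun n : ℕ => C₂ * ((n - 1).factorial : ℝ) * ContFracT.R A K D ^ n) ∧
      ((fun n : ℕ => Real.log |ContFracT.q' A K D a₁ b₀ n * L - ContFracT.p' A K D a₁ b₀ n|)
          ~[atTop] fun n : ℕ => -(n : ℝ) * Real.log |ContFracT.E A K D| / 2) ∧
      ContFracT.T 0 (1 / 2) (1 - 1 / (D : ℂ))
        (1 / 2 + (A : ℂ) / (4 * (D : ℂ) * ContFracT.sqrtC K)) ≠ 0 ∧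
      (L : ℂ) = (b₀ : ℂ) / ((a₁ : ℂ) - ContFracT.sqrtC K * ContFracT.Q A K D) := by
  open ContFracT PerturbedRecurrence in
  have hD0 : D ≠ 0 := by linarith
  have hRpos := R_pos (K := K) (D := D) hA
  have hE1 := one_lt_abs_E hA hK hD hdisc
  have hE0 : E A K D ≠ 0 := fun h => by rw [h, abs_zero] at hE1; linarith
  have hr : |(E A K D)⁻¹| < 1 := by rw [abs_inv]; exact inv_lt_one_of_one_lt₀ hE1
  have hr0 : (E A K D)⁻¹ ≠ 0 := inv_ne_zero hE0
  have hps := isConvergentSol_p A K D a₁ b₀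
  have hqs := isConvergentSol_q A K D a₁ b₀
  have hP := hps.isSol hD0 hRpos.ne' (R_sq hdisc)
  have hQ := hqs.isSol hD0 hRpos.ne' (R_sq hdisc)
  rw [one_div_E] at hP hQ
  have hpert := perturbation_nonneg (D := D) (by linarith)
  have hsum := summable_perturbation D
  have hsum' : Summable fun k => ‖perturbation D k‖ := hsum.norm
  obtain ⟨a, ha⟩ := hP.tendsto hr hsum'
  obtain ⟨b, hb⟩ := hQ.tendsto hr hsum'
  have hm0 := minimalSol_zero_ne_zero hA hK hD hdisc
  rw [sqrtC_mul_Q hA hK hD hdisc] at hden ⊢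
  -- If `b = 0`, then `q` is proportional to the minimal solution, and `q 1 / q 0 = a₁` would equal
  -- `K^(1/2) Q`.
  have hb0 : b ≠ 0 := by
    rintro rfl
    have := hqs.proportional_minimalSol hA hK hD hdisc hb
    rw [q_one, q_zero, Complex.ofReal_one, one_mul] at this
    rw [← this, mul_div_cancel_right₀ _ hm0, sub_self] at hden
    exact hden rfl
  have hw : normalized (R A K D) (p A K D a₁ b₀) 1 * normalized (R A K D) (q A K D a₁ b₀) 0 -
      normalized (R A K D) (p A K D a₁ b₀) 0 * normalized (R A K D) (q A K D a₁ b₀) 1 ≠ 0 := by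
    rw [hps.casoratian_normalized hqs hRpos.ne', p_zero, p_one, q_zero, zero_mul, sub_zero, mul_one]
    have : D - 1 ≠ 0 := by linarith
    positivity
  obtain ⟨c, hc0, hc⟩ := hP.tendsto_sub_div_pow hQ hr hr0 hsum hpert ha hb hb0 hw
  set x := normalized (R A K D) (p A K D a₁ b₀) with hx
  set y := normalized (R A K D) (q A K D a₁ b₀) with hy
  have hN : ∀ k : ℕ, (k.factorial : ℝ) * R A K D ^ (k + 1) ≠ 0 := fun k => by positivity
  have hquot : ∀ k, p A K D a₁ b₀ (k + 1) / q A K D a₁ b₀ (k + 1) = x k / y k := fun k => by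
    rw [hx, hy, normalized, normalized, div_div_div_cancel_right₀ (hN k)]
  have hqy : ∀ k : ℕ, q A K D a₁ b₀ (k + 1) = y k * (k.factorial * R A K D ^ (k + 1)) := fun k => by
    rw [hy, normalized, div_mul_cancel₀ _ (hN k)]
  have herr : ∀ k, a / b - x k / y k = (a / b - x k / y k) / (E A K D)⁻¹ ^ k * (E A K D)⁻¹ ^ k :=
    fun k => (div_mul_cancel₀ _ (pow_ne_zero _ hr0)).symm
  -- The factor `E` in `C₁ = c E` compensates for normalized index `k` standing for `n = k + 1`.
  refine ⟨a / b, ?_, hE1, ⟨c * E A K D, mul_ne_zero hc0 hE0, ?_⟩, ⟨b, hb0, ?_⟩, ?_,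
    T_zero_basePoint_ne_zero hA hK hD hdisc, ?_⟩
  · refine (tendsto_add_atTop_iff_nat 1).1 ((ha.div hb hb0).congr fun k => ?_)
    exact (hquot k).symm
  · refine isEquivalent_of_tendsto_succ_div ?_
    have := hc.div_const c
    rw [div_self hc0] at this
    refine this.congr fun k => ?_
    rw [hquot, pow_succ, inv_pow]
    field_simp
  · refine isEquivalent_of_tendsto_succ_div ?_
    have := hb.div_const b
    rw [div_self hb0] at this
    refine this.congr fun k => ?_
    rw [hqy, Nat.add_sub_cancel]
    have := hN k
    field_simp
  · have hlog := tendsto_log_error hK (by linarith : 0 < D) hRpos hr0 hb0 hc0 hb hc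
    rw [log_rate hK hD hRpos] at hlog
    have hlE : 0 < Real.log |E A K D| := Real.log_pos hE1
    refine isEquivalent_of_tendsto_succ_div ?_
    -- Passes from division by the normalized index `k` to division by `n = k + 1`.
    have hsucc : Tendsto (fun k : ℕ => (k : ℝ) / (k + 1)) atTop (𝓝 1) :=
      tendsto_natCast_div_add_atTop 1
    have := (hlog.mul hsucc).div_const (-(Real.log |E A K D| / 2))
    rw [mul_one, div_self (by linarith)] at this
    refine this.congr' ?_
    filter_upwards [eventually_gt_atTop 0, hb.eventually_ne hb0] with k hk hyk
    have hk' : (k : ℝ) ≠ 0 := by exact_mod_cast hk.ne'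
    have hk1 : (k : ℝ) + 1 ≠ 0 := by positivity
    have hval : q' A K D a₁ b₀ (k + 1) * (a / b) - p' A K D a₁ b₀ (k + 1) =
        y k * (k.factorial * R A K D ^ (k + 1)) *
          ((a / b - x k / y k) / (E A K D)⁻¹ ^ k * (E A K D)⁻¹ ^ k) / f K D (k + 1) := by
      rw [← herr, ← hquot, ← hqy, q', p']
      have : q A K D a₁ b₀ (k + 1) ≠ 0 := by rw [hqy]; exact mul_ne_zero hyk (hN k)
      field_simp
    rw [hval]
    push_cast
    field_simp
  -- With `L = a / b`, the solution `p - L q` is null, hence proportional to the minimal one. Its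
  -- initial values are `-L` and `b₀ - L a₁`, so `b₀ - L a₁ = -L K^(1/2) Q`.
  · set v : ℕ → ℝ := fun n => p A K D a₁ b₀ n - a / b * q A K D a₁ b₀ n with hv
    have hvs : IsConvergentSol A K D v := fun n => by
      simp only [hv]; rw [hps n, hqs n]; ring
    have hv0 : Tendsto (normalized (R A K D) v) atTop (𝓝 0) := by
      have := ha.sub (hb.const_mul (a / b))
      rw [div_mul_cancel₀ _ hb0, sub_self] at this
      refine this.congr fun k => ?_
      simp only [hx, hy, hv, normalized]
      ring
    have := hvs.proportional_minimalSol hA hK hD hdisc hv0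
    simp only [hv, p_one, q_one, p_zero, q_zero] at this
    rw [eq_div_iff hden]
    push_cast at this ⊢
    have h2 : (b₀ - a / b * a₁ : ℂ) = -(a / b) * (minimalSol A K D 1 / minimalSol A K D 0) := by
      rw [mul_div_assoc', eq_div_iff hm0, this]; ring
    linear_combination -h2
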